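/- Let $\mathbb{k}$ be a field of characteristic $0$, let $\mathcal P=\mathbb{k}[x_1,\dots,x_n]$, and use the degree reverse lexicographic order with $x_1\succ x_2\succ\cdots\succ x_n$ to select leading terms $\mathrm{lt}$, so that the leading ideal of an ideal $\mathcal I$ is $\mathrm{lt}\,\mathcal I=\langle \mathrm{lt}\,f \mid 0\neq f\in\mathcal I\rangle$. A monomial ideal $\mathcal J$ is *strongly stable* if for every term $x^\mu\in\mathcal J$ and all $i<j$ with $x_j\mid x^\mu$ also $x_i x^\mu/x_j\in\mathcal J$; an ideal $\mathcal I$ is *in strongly stable position* if $\mathrm{lt}\,\mathcal I$ is strongly stable. The pure reverse lexicographic order on terms is defined by: $x^\mu\prec_{\mathrm{rl}}x^\nu$ iff $\mu\ne\nu$ and, for the largest index $i$ with $\mu_i\neq\nu_i$, one has $\mu_i>\nu_i$. For a finite set $F$ of non-zero polynomials let $\mathrm{ls}(F)$ be the list of the leading terms of its elements, in descending order for $\prec_{\mathrm{rl}}$. For lists of terms put $(t_1,\dots,t_\ell)\prec_{\mathrm{ls}}(\tilde t_1,\dots,\tilde t_{\tilde\ell})$ iff either there is $j\le\min(\ell,\tilde\ell)$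 with $t_i=\tilde t_i$ for all $i<j$ and $t_j\prec_{\mathrm{rl}}\tilde t_j$, or $t_j=\tilde t_j$ for all $j\le\min(\ell,\tilde\ell)$ and $\ell<\tilde\ell$. We write $\succeq_{\mathrm{ls}}$ for "$\succ_{\mathrm{ls}}$ or equal". Algorithm SS-Trafo has as input the reduced Gröbner basis $G$ of a homogeneous ideal $\mathcal I\unlhd\mathcal P$ and proceeds as follows. 1. Put $\Psi:=\mathrm{id}$. 2. While there are $g\in G$ and $1\le i<j\le n$ such that $x_j\mid\mathrm{lt}\,g$ and $x_i\,\mathrm{lt}(g)/x_j\notin\langle\mathrm{lt}\,G\rangle$, choose such $g,i,j$ arbitrarily, let $\psi$ be the elementary move $x_j\mapsto x_j+x_i$ (all other variables fixed), and do the following: - put $\Psi:=\psi\circ\Psi$ and let $\tilde G$ be the reduced Gröbner basis of $\langle\psi(G)\rangle$; - while $\mathrm{ls}(G)\succeq_{\mathrm{ls}}\mathrm{ls}(\tilde G)$, put $\Psi:=\psi\circ\Psi$ and replace $\tilde G$ by the reduced Gröbner basis of $\langle\psi(\tilde G)\rangle$; - put $G:=\tilde G$. 3. Return $\Psi$. **Theorem.**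 Whatever choices are made in step 2, Algorithm SS-Trafo terminates after finitely many steps. It returns a linear change of coordinates $\Psi\in\mathrm{GL}(n,\mathbb{k})$, which is a (possibly empty) product of elementary moves $x_j\mapsto x_j+x_i$ with $i<j$, such that $\Psi(\mathcal I)$ is in strongly stable position. -/

import Mathlib

open MvPolynomial

namespace SSTrafo

/-! Terms `x^μ` in the variables `x_0, …, x_{n-1}` are represented by their exponent vectors
`μ : Fin n →₀ ℕ`; the variable with the smallest index is the largest one. -/

/-- The strict pure reverse lexicographic order: `x^μ ≺ x^ν` iff `μ ≠ ν` and, at the largest index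
where the exponents differ, `μ` has the larger exponent. It is not a term order. -/
def RevLexLT {n : ℕ} (μ ν : Fin n →₀ ℕ) : Prop :=
  ∃ i, ν i < μ i ∧ ∀ l, i < l → μ l = ν l

theorem RevLexLT.irrefl {n : ℕ} (μ : Fin n →₀ ℕ) : ¬ RevLexLT μ μ := by
  rintro ⟨i, hi, -⟩
  exact lt_irrefl _ hi

theorem RevLexLT.trans {n : ℕ} {μ ν ρ : Fin n →₀ ℕ} (h : RevLexLT μ ν) (h' : RevLexLT ν ρ) :
    RevLexLT μ ρ := by
  obtain ⟨i, hi, hi'⟩ := h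
  obtain ⟨j, hj, hj'⟩ := h'
  rcases lt_trichotomy i j with hij | rfl | hij
  · exact ⟨j, by rw [hi' j hij]; exact hj, fun l hl => by rw [hi' l (hij.trans hl), hj' l hl]⟩
  · exact ⟨i, hj.trans hi, fun l hl => by rw [hi' l hl, hj' l hl]⟩
  · exact ⟨i, by rw [← hj' i hij]; exact hi, fun l hl => by rw [hi' l hl, hj' l (hij.trans hl)]⟩

theorem RevLexLT.trichotomous {n : ℕ} (μ ν : Fin n →₀ ℕ) :
    RevLexLT μ ν ∨ μ = ν ∨ RevLexLT ν μ := by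
  classical
  by_cases h : μ = ν
  · exact Or.inr (Or.inl h)
  · have hne : (Finset.univ.filter fun i => μ i ≠ ν i).Nonempty := by
      by_contra hcon
      rw [Finset.not_nonempty_iff_eq_empty, Finset.filter_eq_empty_iff] at hcon
      exact h (Finsupp.ext fun i => not_not.1 (hcon (Finset.mem_univ i)))
    have hmem := Finset.max'_mem _ hne
    have hmax : ∀ l, (Finset.univ.filter fun i => μ i ≠ ν i).max' hne < l → μ l = ν l := by
      intro l hl
      by_contra hcon
      exact absurd (Finset.le_max' _ l (by simpa using hcon)) (not_le.2 hl)
    generalize (Finset.univ.filter fun i => μ i ≠ ν i).max' hne = i at hmem hmax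
    rcases lt_or_gt_of_ne (Finset.mem_filter.1 hmem).2 with hlt | hlt
    · exact Or.inr (Or.inr ⟨i, hlt, fun l hl => (hmax l hl).symm⟩)
    · exact Or.inl ⟨i, hlt, hmax⟩

/-- The strict degree reverse lexicographic order. -/
def DegRevLexLT {n : ℕ} (μ ν : Fin n →₀ ℕ) : Prop :=
  μ.degree < ν.degree ∨ μ.degree = ν.degree ∧ RevLexLT μ ν

theorem DegRevLexLT.irrefl {n : ℕ} (μ : Fin n →₀ ℕ) : ¬ DegRevLexLT μ μ := by
  rintro (h | ⟨-, h⟩)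
  · exact lt_irrefl _ h
  · exact RevLexLT.irrefl μ h

theorem DegRevLexLT.trans {n : ℕ} {μ ν ρ : Fin n →₀ ℕ} (h : DegRevLexLT μ ν)
    (h' : DegRevLexLT ν ρ) : DegRevLexLT μ ρ := by
  rcases h with h | ⟨h, hr⟩ <;> rcases h' with h' | ⟨h', hr'⟩
  · exact Or.inl (h.trans h')
  · exact Or.inl (h' ▸ h)
  · exact Or.inl (h ▸ h')
  · exact Or.inr ⟨h.trans h', hr.trans hr'⟩

theorem DegRevLexLT.trichotomous {n : ℕ} (μ ν : Fin n →₀ ℕ) :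
    DegRevLexLT μ ν ∨ μ = ν ∨ DegRevLexLT ν μ := by
  rcases lt_trichotomy μ.degree ν.degree with h | h | h
  · exact Or.inl (Or.inl h)
  · rcases RevLexLT.trichotomous μ ν with h' | h' | h'
    · exact Or.inl (Or.inr ⟨h, h'⟩)
    · exact Or.inr (Or.inl h')
    · exact Or.inr (Or.inr (Or.inr ⟨h.symm, h'⟩))
  · exact Or.inr (Or.inr (Or.inl h))

theorem DegRevLexLT.add_right {n : ℕ} {μ ν : Fin n →₀ ℕ} (h : DegRevLexLT μ ν)
    (ρ : Fin n →₀ ℕ) : DegRevLexLT (μ + ρ) (ν + ρ) := by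
  rcases h with h | ⟨h, i, hi, hi'⟩
  · exact Or.inl (by simpa using h)
  · exact Or.inr ⟨by simpa using h, i, by simpa using hi, fun l hl => by simp [hi' l hl]⟩

/-- A copy of `Fin n →₀ ℕ`, to carry the degree reverse lexicographic order. -/
def DegRevLexSyn (n : ℕ) : Type := Fin n →₀ ℕ

noncomputable instance (n : ℕ) : AddCommMonoid (DegRevLexSyn n) :=
  inferInstanceAs (AddCommMonoid (Fin n →₀ ℕ))

open Classical in
noncomputable instance (n : ℕ) : LinearOrder (DegRevLexSyn n) where
  le a b := a = b ∨ @DegRevLexLT n a b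
  lt a b := @DegRevLexLT n a b
  le_refl a := Or.inl rfl
  le_trans a b c hab hbc := by
    rcases hab with rfl | hab
    · exact hbc
    · rcases hbc with rfl | hbc
      · exact Or.inr hab
      · exact Or.inr (DegRevLexLT.trans hab hbc)
  lt_iff_le_not_ge a b := by
    constructor
    · intro h
      refine ⟨Or.inr h, ?_⟩
      rintro (rfl | h')
      · exact DegRevLexLT.irrefl _ h
      · exact DegRevLexLT.irrefl _ (DegRevLexLT.trans h h')
    · rintro ⟨rfl | h, h'⟩
      · exact absurd (Or.inl rfl) h'
      · exact h
  le_antisymm a b hab hba := by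
    rcases hab with rfl | hab
    · rfl
    · rcases hba with rfl | hba
      · rfl
      · exact absurd (DegRevLexLT.trans hab hba) (DegRevLexLT.irrefl _)
  le_total a b := by
    rcases @DegRevLexLT.trichotomous n a b with h | h | h
    · exact Or.inl (Or.inr h)
    · exact Or.inl (Or.inl h)
    · exact Or.inr (Or.inr h)
  toDecidableLE := Classical.decRel _

instance (n : ℕ) : IsOrderedAddMonoid (DegRevLexSyn n) where
  add_le_add_left a b h c := by
    rcases h with rfl | h
    · exact le_refl _
    · exact Or.inr (DegRevLexLT.add_right h c)

theorem degRevLexSyn_mono {n : ℕ} {μ ν : Fin n →₀ ℕ} (h : μ ≤ ν) :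
    (show DegRevLexSyn n from μ) ≤ (show DegRevLexSyn n from ν) := by
  rcases DegRevLexLT.trichotomous μ ν with h' | h' | h'
  · exact Or.inr h'
  · exact Or.inl h'
  · exfalso
    obtain ⟨ρ, rfl⟩ := exists_add_of_le h
    rcases h' with h' | ⟨h', i, hi, -⟩
    · simp at h'
    · have hρ : ρ = 0 := (Finsupp.degree_eq_zero_iff ρ).1 (by simpa using h')
      simp [hρ] at hi

instance (n : ℕ) : WellFoundedLT (DegRevLexSyn n) := by
  refine ⟨wellFounded_iff_isEmpty_descending_chain.2 ⟨?_⟩⟩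
  rintro ⟨f, hf⟩
  obtain ⟨i, j, hij, hle⟩ :=
    wellQuasiOrdered_le (α := Fin n →₀ ℕ) (fun k => (f k : Fin n →₀ ℕ))
  exact absurd (degRevLexSyn_mono hle) (not_le.2 (strictAnti_nat_of_succ_lt hf hij))

/-- The degree reverse lexicographic order, as a `MonomialOrder`. -/
noncomputable def degRevLex (n : ℕ) : MonomialOrder (Fin n) where
  syn := DegRevLexSyn n
  toSyn := { toEquiv := Equiv.refl (Fin n →₀ ℕ), map_add' := fun _ _ => rfl }
  toSyn_monotone _ _ h := degRevLexSyn_mono h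

theorem degRevLex_lt_iff {n : ℕ} {μ ν : Fin n →₀ ℕ} :
    (degRevLex n).toSyn μ < (degRevLex n).toSyn ν ↔
      μ.degree < ν.degree ∨ μ.degree = ν.degree ∧ RevLexLT μ ν :=
  Iff.rfl

section Ideals

variable {k : Type*} [Field k] {n : ℕ}

/-- Homogeneous ideals of the polynomial ring, with its standard grading by the total degree. -/
def IsHomogeneousIdeal (I : Ideal (MvPolynomial (Fin n) k)) : Prop :=
  letI : GradedAlgebra (homogeneousSubmodule (Fin n) k) := MvPolynomial.gradedAlgebra
  I.IsHomogeneous (homogeneousSubmodule (Fin n) k)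

/-- The exponent vector of the leading term, with respect to the degree reverse lexicographic
order, of a polynomial (meaningful for non-zero polynomials). -/
noncomputable def ltExp (f : MvPolynomial (Fin n) k) : Fin n →₀ ℕ :=
  (degRevLex n).degree f

/-- The monomial ideal generated by the leading terms of the non-zero elements of a set. -/
noncomputable def ltSpan (S : Set (MvPolynomial (Fin n) k)) : Ideal (MvPolynomial (Fin n) k) :=
  Ideal.span {t | ∃ f ∈ S, f ≠ 0 ∧ t = monomial (ltExp f) 1}

/-- The leading ideal of an ideal. -/
noncomputable def leadingIdeal (I : Ideal (MvPolynomial (Fin n) k)) :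
    Ideal (MvPolynomial (Fin n) k) :=
  ltSpan (I : Set (MvPolynomial (Fin n) k))

/-- `G` is the reduced Gröbner basis of `I` for the degree reverse lexicographic order: a Gröbner
basis of `I` consisting of monic polynomials such that no term in the support of an element is
divisible by the leading term of another element. -/
structure IsReducedGroebnerBasis (G : Finset (MvPolynomial (Fin n) k))
    (I : Ideal (MvPolynomial (Fin n) k)) : Prop where
  subset : ∀ g ∈ G, g ∈ I
  ltSpan_eq : ltSpan (G : Set (MvPolynomial (Fin n) k)) = leadingIdeal I
  ne_zero : ∀ g ∈ G, g ≠ 0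
  monic : ∀ g ∈ G, coeff (ltExp g) g = 1
  reduced : ∀ g ∈ G, ∀ h ∈ G, g ≠ h → ∀ μ ∈ g.support, ¬ ltExp h ≤ μ

/-- The exponent vector of the term `x_i * x^μ / x_j` (for `x_j` dividing `x^μ`). -/
noncomputable def moveTerm (i j : Fin n) (μ : Fin n →₀ ℕ) : Fin n →₀ ℕ :=
  Finsupp.single i 1 + (μ - Finsupp.single j 1)

/-- A strongly stable monomial ideal: for every term `x^μ` in it and all `i < j` such that `x_j`
divides `x^μ`, the term `x_i * x^μ / x_j` lies in the ideal, too. -/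
def IsStronglyStable (J : Ideal (MvPolynomial (Fin n) k)) : Prop :=
  (∃ S : Set (Fin n →₀ ℕ), J = Ideal.span ((fun μ => monomial μ (1 : k)) '' S)) ∧
    ∀ μ : Fin n →₀ ℕ, monomial μ (1 : k) ∈ J →
      ∀ i j : Fin n, i < j → μ j ≠ 0 → monomial (moveTerm i j μ) (1 : k) ∈ J

/-- `I` is in strongly stable position: its leading ideal is strongly stable. -/
def InStronglyStablePosition (I : Ideal (MvPolynomial (Fin n) k)) : Prop :=
  IsStronglyStable (leadingIdeal I)

/-- The linear coordinate transformation `x_i ↦ ∑_j A_{ij} x_j` given by an invertible matrix. -/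
noncomputable def linearChange (A : GL (Fin n) k) :
    MvPolynomial (Fin n) k →ₐ[k] MvPolynomial (Fin n) k :=
  aeval fun i => ∑ j, C ((A : Matrix (Fin n) (Fin n) k) i j) * X j

/-- The elementary move `x_j ↦ x_j + x_i`; all other variables are fixed. -/
noncomputable def elementaryMove (k : Type*) [Field k] {n : ℕ} (i j : Fin n) :
    MvPolynomial (Fin n) k →ₐ[k] MvPolynomial (Fin n) k :=
  aeval fun l => if l = j then X j + X i else X l

end Ideals

section LeadingTermLists

/-- The (non-strict) relation `x^μ ⪰ x^ν` for the pure reverse lexicographic order. -/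
def RevLexGE {n : ℕ} (μ ν : Fin n →₀ ℕ) : Prop := μ = ν ∨ RevLexLT ν μ

noncomputable instance {n : ℕ} : DecidableRel (@RevLexGE n) := Classical.decRel _

instance {n : ℕ} : IsTrans (Fin n →₀ ℕ) RevLexGE where
  trans a b c hab hbc := by
    rcases hab with rfl | hab
    · exact hbc
    · rcases hbc with rfl | hbc
      · exact Or.inr hab
      · exact Or.inr (hbc.trans hab)

instance {n : ℕ} : Std.Antisymm (@RevLexGE n) where
  antisymm a b hab hba := by
    rcases hab with rfl | hab
    · rfl
    · rcases hba with rfl | hba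
      · rfl
      · exact absurd (hab.trans hba) (RevLexLT.irrefl _)

instance {n : ℕ} : Std.Total (@RevLexGE n) where
  total a b := by
    rcases RevLexLT.trichotomous a b with h | h | h
    · exact Or.inr (Or.inr h)
    · exact Or.inl (Or.inl h)
    · exact Or.inl (Or.inr h)

open Classical in
/-- The list of the leading terms of a finite set of (non-zero) polynomials, in strictly
descending order with respect to the pure reverse lexicographic order. -/
noncomputable def ls {k : Type*} [Field k] {n : ℕ} (F : Finset (MvPolynomial (Fin n) k)) :
    List (Fin n →₀ ℕ) :=
  (F.image ltExp).sort RevLexGE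

/-- The strict order `≺_ls` on lists of terms: at the first position where the lists differ the
entry of the first list is smaller, or the first list is a proper initial segment. -/
def LsLT {n : ℕ} (s t : List (Fin n →₀ ℕ)) : Prop :=
  (∃ (j : ℕ) (hs : j < s.length) (ht : j < t.length),
      (∀ (i : ℕ) (hi : i < j), s[i] = t[i]) ∧ RevLexLT s[j] t[j]) ∨
    ((∀ (j : ℕ) (hs : j < s.length) (ht : j < t.length), s[j] = t[j]) ∧ s.length < t.length)

/-- `s ⪯_ls t`. -/
def LsLE {n : ℕ} (s t : List (Fin n →₀ ℕ)) : Prop := LsLT s t ∨ s = t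

end LeadingTermLists

section Algorithm

/-- The obstructions to strong stability for which the algorithm searches: `(g, i, j)` such that
`g ∈ G`, `i < j`, `x_j` divides the leading term `lt g` and `x_i * lt g / x_j` is not in the ideal generated by the leading
terms of `G`. -/
def IsObstruction {k : Type*} [Field k] {n : ℕ} (G : Finset (MvPolynomial (Fin n) k))
    (g : MvPolynomial (Fin n) k) (i j : Fin n) : Prop :=
  g ∈ G ∧ i < j ∧ ltExp g j ≠ 0 ∧
    monomial (moveTerm i j (ltExp g)) (1 : k) ∉ ltSpan (G : Set (MvPolynomial (Fin n) k))

/-- The possible values of `ReducedGroebnerBasis(ψ(G))` where `ψ = (x_j ↦ x_j + x_i)`. -/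
def IsMovedBasis {k : Type*} [Field k] {n : ℕ} (i j : Fin n)
    (G G' : Finset (MvPolynomial (Fin n) k)) : Prop :=
  IsReducedGroebnerBasis G'
    (Ideal.span (elementaryMove k i j '' (G : Set (MvPolynomial (Fin n) k))))

/-- The configurations of the algorithm SS-Trafo, with the current values of its variables. -/
inductive Config (k : Type*) [Field k] (n : ℕ)
  /-- about to test the condition of the outer `while` loop -/
  | outer (Ψ : MvPolynomial (Fin n) k →ₐ[k] MvPolynomial (Fin n) k)
      (G : Finset (MvPolynomial (Fin n) k))
  /-- about to test the condition of the inner `while` loop, `Gt` being the value of `G̃` -/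
  | inner (Ψ : MvPolynomial (Fin n) k →ₐ[k] MvPolynomial (Fin n) k) (i j : Fin n)
      (G Gt : Finset (MvPolynomial (Fin n) k))
  /-- stopped, with output `Ψ` -/
  | returned (Ψ : MvPolynomial (Fin n) k →ₐ[k] MvPolynomial (Fin n) k)

/-- The steps of the algorithm SS-Trafo. The choice of an obstruction is non-deterministic. -/
inductive Step {k : Type*} [Field k] {n : ℕ} : Config k n → Config k n → Prop
  /-- there is an obstruction: apply `ψ = (x_j ↦ x_j + x_i)`, i.e. put `Ψ := ψ ∘ Ψ` and
  `G̃ := ReducedGroebnerBasis(ψ(G))` -/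
  | enter {Ψ G Gt g i j} (hobs : IsObstruction G g i j) (hGt : IsMovedBasis i j G Gt) :
      Step (.outer Ψ G) (.inner ((elementaryMove k i j).comp Ψ) i j G Gt)
  /-- `while ls(G) ⪰ ls(G̃)`: put `Ψ := ψ ∘ Ψ` and `G̃ := ReducedGroebnerBasis(ψ(G̃))` -/
  | again {Ψ i j G Gt Gt'} (hguard : LsLE (ls Gt) (ls G)) (hGt : IsMovedBasis i j Gt Gt') :
      Step (.inner Ψ i j G Gt) (.inner ((elementaryMove k i j).comp Ψ) i j G Gt')
  /-- the inner loop ends: put `G := G̃` -/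
  | leave {Ψ i j G Gt} (hguard : ¬ LsLE (ls Gt) (ls G)) :
      Step (.inner Ψ i j G Gt) (.outer Ψ Gt)
  /-- there is no obstruction: return `Ψ` -/
  | finish {Ψ G} (hobs : ¬ ∃ g i j, IsObstruction G g i j) :
      Step (.outer Ψ G) (.returned Ψ)

/-- The configuration after the initialisation `Ψ := id`, on input `G`. -/
noncomputable def Config.start {k : Type*} [Field k] {n : ℕ} (G : Finset (MvPolynomial (Fin n) k)) :
    Config k n :=
  .outer (AlgHom.id k _) G

end Algorithm

end SSTrafo

/-!
Write `J` for the leading ideal of `I`, given by the upper set `leadExps I` of exponent vectors, and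
`ψ_a` for the transformation `x_j ↦ x_j + a x_i`, so that the `m`-th power of an elementary move is
`ψ_m`.

*The inner loop ends.* For a term `x^t` count the leading terms of the same degree as `x^t` that are
at least `x^t`. Choose elements of `I` with these leading terms and apply `ψ_a`. Their coefficients
with respect to the same terms form a matrix that is polynomial in `a` and triangular at `a = 0`, so
for all but finitely many `a` the count for `ψ_a(I)` is not smaller than that for `I`
(`finite_setOf_ncard_leadExpsGE_lt`). Let `(g, i, j)` be an obstruction and `x^u = x_i lt(g) / x_j`,
which is not in `J`. Among the terms from `x^u` upwards, `a⁻¹ ψ_a(g)` tends to `x_i ∂g/∂x_j`, whose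
leading term is `x^u` in characteristic zero. This yields a further row of the matrix, and hence the
count at `x^u` increases for all but finitely many `a`
(`finite_setOf_ncard_leadExpsGE_moveTerm_le`). Since a divisor of a term is at least as large in the
pure reverse lexicographic order, these counts control the lists of leading terms, and some power of
the elementary move makes the list strictly larger (`exists_lsLT_of_isObstruction`).

*The outer loop ends.* Its iterations produce strictly increasing lists, and a list is determined by
the leading ideal. All the ideals have the same Hilbert function, and only finitely many leading
ideals are possible then: a limit of a sequence of such ideals along an ultrafilter is finitely
generated, hence contained in most members of the sequence, and equal to them because the Hilbert
functions agree (`exists_lt_leadExps_eq`).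

The degree reverse lexicographic order refines the total degree, so the Hilbert function can be
taken to be the dimension of the space of elements of degree at most `d`
(`ncard_leadExps_degree_le`).

Every ideal has a reduced Gröbner basis (`exists_isReducedGroebnerBasis`), so the algorithm cannot
get stuck, and when no obstruction is left, strong stability of the leading terms of the basis
extends to all of `J` (`inStronglyStablePosition_of_forall_not_isObstruction`).
-/

namespace SSTrafo

variable {k : Type*} [Field k] {n : ℕ}

/-! ### Leading exponents -/

/-- The exponent vectors of the leading terms of the non-zero elements of a set of polynomials. -/
def leadExps (S : Set (MvPolynomial (Fin n) k)) : Set (Fin n →₀ ℕ) :=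
  {μ | ∃ f ∈ S, f ≠ 0 ∧ ltExp f = μ}

theorem ltExp_mem_leadExps {S : Set (MvPolynomial (Fin n) k)} {f : MvPolynomial (Fin n) k}
    (hf : f ∈ S) (h0 : f ≠ 0) : ltExp f ∈ leadExps S :=
  ⟨f, hf, h0, rfl⟩

theorem coeff_ltExp_ne_zero {f : MvPolynomial (Fin n) k} (h0 : f ≠ 0) : coeff (ltExp f) f ≠ 0 :=
  (degRevLex n).coeff_degree_ne_zero_iff.2 h0

theorem le_ltExp {f : MvPolynomial (Fin n) k} {μ : Fin n →₀ ℕ} (h : coeff μ f ≠ 0) :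
    (degRevLex n).toSyn μ ≤ (degRevLex n).toSyn (ltExp f) :=
  (degRevLex n).le_degree (mem_support_iff.2 h)

theorem coeff_eq_zero_of_ltExp_lt {f : MvPolynomial (Fin n) k} {μ : Fin n →₀ ℕ}
    (h : (degRevLex n).toSyn (ltExp f) < (degRevLex n).toSyn μ) : coeff μ f = 0 :=
  (degRevLex n).coeff_eq_zero_of_lt h

theorem degree_le_of_toSyn_le {μ ν : Fin n →₀ ℕ}
    (h : (degRevLex n).toSyn μ ≤ (degRevLex n).toSyn ν) : μ.degree ≤ ν.degree := by
  rcases h.eq_or_lt with h | h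
  · rw [(degRevLex n).toSyn.injective h]
  · rcases degRevLex_lt_iff.1 h with h | h
    · exact h.le
    · exact h.1.le

theorem degree_ltExp (f : MvPolynomial (Fin n) k) : (ltExp f).degree = f.totalDegree := by
  by_cases h0 : f = 0
  · simp [h0, ltExp]
  apply le_antisymm
  · exact le_totalDegree (mem_support_iff.2 (coeff_ltExp_ne_zero h0))
  · exact Finset.sup_le fun μ hμ => degree_le_of_toSyn_le (le_ltExp (mem_support_iff.1 hμ))

/-- The leading exponents of an ideal form an upper set for divisibility of terms. -/
theorem leadExps_mono (I : Ideal (MvPolynomial (Fin n) k)) {μ ν : Fin n →₀ ℕ}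
    (hμ : μ ∈ leadExps (I : Set (MvPolynomial (Fin n) k))) (h : μ ≤ ν) :
    ν ∈ leadExps (I : Set (MvPolynomial (Fin n) k)) := by
  obtain ⟨f, hf, h0, rfl⟩ := hμ
  obtain ⟨ρ, rfl⟩ := exists_add_of_le h
  have hm : monomial ρ (1 : k) ≠ 0 := by simp
  refine ⟨f * monomial ρ 1, I.mul_mem_right _ hf, mul_ne_zero h0 hm, ?_⟩
  classical
  rw [ltExp, (degRevLex n).degree_mul h0 hm, (degRevLex n).degree_monomial]
  simp [ltExp]

theorem ltSpan_eq_span_image (S : Set (MvPolynomial (Fin n) k)) :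
    ltSpan S = Ideal.span ((fun μ => monomial μ (1 : k)) '' leadExps S) := by
  unfold ltSpan leadExps
  congr 1
  ext t
  constructor
  · rintro ⟨f, hf, h0, rfl⟩
    exact ⟨_, ⟨f, hf, h0, rfl⟩, rfl⟩
  · rintro ⟨_, ⟨f, hf, h0, rfl⟩, rfl⟩
    exact ⟨f, hf, h0, rfl⟩

theorem monomial_mem_ltSpan_iff {S : Set (MvPolynomial (Fin n) k)} {μ : Fin n →₀ ℕ} :
    monomial μ (1 : k) ∈ ltSpan S ↔ ∃ ν ∈ leadExps S, ν ≤ μ := by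
  rw [ltSpan_eq_span_image, mem_ideal_span_monomial_image]
  classical
  simp [support_monomial]

theorem monomial_mem_leadingIdeal_iff {I : Ideal (MvPolynomial (Fin n) k)} {μ : Fin n →₀ ℕ} :
    monomial μ (1 : k) ∈ leadingIdeal I ↔ μ ∈ leadExps (I : Set (MvPolynomial (Fin n) k)) := by
  rw [leadingIdeal, monomial_mem_ltSpan_iff]
  exact ⟨fun ⟨ν, hν, h⟩ => leadExps_mono I hν h, fun h => ⟨μ, h, le_rfl⟩⟩

/-! ### Counting leading exponents -/

/-- Vectors with a triangular table of coordinates are linearly independent. -/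
theorem linearIndependent_of_triangular {ι α V : Type*} [LinearOrder α] [AddCommGroup V]
    [Module k V] {b : ι → α} (hb : Function.Injective b) {φ : ι → V →ₗ[k] k} {w : ι → V}
    (hlt : ∀ i j, b i < b j → φ j (w i) = 0) (hdiag : ∀ i, φ i (w i) ≠ 0) :
    LinearIndependent k w := by
  classical
  rw [linearIndependent_iff']
  intro s c hsum
  by_contra! hne
  have hT : (s.filter fun i => c i ≠ 0).Nonempty := by
    obtain ⟨i, hi, hci⟩ := hne
    exact ⟨i, Finset.mem_filter.2 ⟨hi, hci⟩⟩
  obtain ⟨m, hm, hmax⟩ := Finset.exists_max_image _ b hT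
  obtain ⟨hms, hcm⟩ := Finset.mem_filter.1 hm
  have h := congrArg (φ m) hsum
  rw [map_sum, map_zero, Finset.sum_eq_single_of_mem m hms] at h
  · rw [map_smul, smul_eq_mul] at h
    exact mul_ne_zero hcm (hdiag m) h
  · intro i hi him
    rw [map_smul, smul_eq_mul]
    by_cases hci : c i = 0
    · rw [hci, zero_mul]
    · have hle := hmax i (Finset.mem_filter.2 ⟨hi, hci⟩)
      rw [hlt i m (lt_of_le_of_ne hle fun h => him (hb h)), mul_zero]

/-- A space of polynomials has as many leading exponents as its dimension says. -/
theorem ncard_leadExps_eq_finrank (V : Submodule k (MvPolynomial (Fin n) k))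
    [FiniteDimensional k V] (hfin : (leadExps (V : Set (MvPolynomial (Fin n) k))).Finite) :
    (leadExps (V : Set (MvPolynomial (Fin n) k))).ncard = Module.finrank k V := by
  classical
  set E := leadExps (V : Set (MvPolynomial (Fin n) k)) with hE
  have : Fintype E := hfin.fintype
  rw [← Nat.card_coe_set_eq, Nat.card_eq_fintype_card]
  apply le_antisymm
  · choose w hwV hw0 hw using fun e : E => e.2
    refine LinearIndependent.fintype_card_le_finrank (b := fun e : E => (⟨w e, hwV e⟩ : V)) ?_
    refine linearIndependent_of_triangular (b := fun e : E => (degRevLex n).toSyn e.1)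
      (φ := fun e => lcoeff k e.1 ∘ₗ V.subtype) ?_ ?_ ?_
    · exact fun a b h => Subtype.ext ((degRevLex n).toSyn.injective h)
    · intro e e' h
      exact coeff_eq_zero_of_ltExp_lt (by rw [Submodule.subtype_apply, hw]; exact h)
    · intro e
      have := coeff_ltExp_ne_zero (hw0 e)
      rw [hw] at this
      exact this
  · rw [← Module.finrank_fintype_fun_eq_card k (η := E)]
    refine LinearMap.finrank_le_finrank_of_injective
      (f := LinearMap.pi fun e : E => lcoeff k e.1 ∘ₗ V.subtype) ?_
    rw [← LinearMap.ker_eq_bot, LinearMap.ker_eq_bot']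
    rintro ⟨f, hf⟩ h
    by_contra hne
    have h0 : f ≠ 0 := fun h => hne (Subtype.ext h)
    exact coeff_ltExp_ne_zero h0 (congrFun h ⟨ltExp f, ltExp_mem_leadExps hf h0⟩)

/-- The elements of total degree at most `d` of an ideal. -/
noncomputable def idealLE (I : Ideal (MvPolynomial (Fin n) k)) (d : ℕ) :
    Submodule k (MvPolynomial (Fin n) k) :=
  I.restrictScalars k ⊓ restrictTotalDegree (Fin n) k d

theorem mem_idealLE {I : Ideal (MvPolynomial (Fin n) k)} {d : ℕ} {f : MvPolynomial (Fin n) k} :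
    f ∈ idealLE I d ↔ f ∈ I ∧ f.totalDegree ≤ d := by
  simp [idealLE, mem_restrictTotalDegree]

instance (I : Ideal (MvPolynomial (Fin n) k)) (d : ℕ) : FiniteDimensional k (idealLE I d) :=
  Submodule.finiteDimensional_inf_right _ _

theorem ncard_leadExps_degree_le (I : Ideal (MvPolynomial (Fin n) k)) (d : ℕ) :
    {μ ∈ leadExps (I : Set (MvPolynomial (Fin n) k)) | μ.degree ≤ d}.ncard =
      Module.finrank k (idealLE I d) := by
  have h : {μ ∈ leadExps (I : Set (MvPolynomial (Fin n) k)) | μ.degree ≤ d} =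
      leadExps (idealLE I d : Set (MvPolynomial (Fin n) k)) := by
    ext μ
    constructor
    · rintro ⟨⟨f, hf, h0, rfl⟩, hd⟩
      exact ⟨f, mem_idealLE.2 ⟨hf, degree_ltExp f ▸ hd⟩, h0, rfl⟩
    · rintro ⟨f, hf, h0, rfl⟩
      obtain ⟨hf, hd⟩ := mem_idealLE.1 hf
      exact ⟨⟨f, hf, h0, rfl⟩, degree_ltExp f ▸ hd⟩
  rw [h]
  refine ncard_leadExps_eq_finrank _ ((Finsupp.finite_of_degree_le d).subset ?_)
  rw [← h]
  exact fun μ hμ => hμ.2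

/-- The leading exponents of `I` of the same degree as `t` whose terms are at least `x^t`. -/
def leadExpsGE (I : Ideal (MvPolynomial (Fin n) k)) (t : Fin n →₀ ℕ) : Set (Fin n →₀ ℕ) :=
  {μ ∈ leadExps (I : Set (MvPolynomial (Fin n) k)) |
    μ.degree = t.degree ∧ (degRevLex n).toSyn t ≤ (degRevLex n).toSyn μ}

theorem finite_leadExpsGE (I : Ideal (MvPolynomial (Fin n) k)) (t : Fin n →₀ ℕ) :
    (leadExpsGE I t).Finite :=
  (Finsupp.finite_of_degree_eq t.degree).subset fun _ hμ => hμ.2.1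

/-- If some elements of `I` of degree at most `|t|` have an invertible matrix of coefficients with
respect to terms that are at least `x^t`, then every non-zero linear combination of them has a
leading term that is at least `x^t`; so `I` has at least as many leading terms of this kind. -/
theorem card_le_ncard_leadExpsGE (I : Ideal (MvPolynomial (Fin n) k)) {t : Fin n →₀ ℕ}
    (T : Finset (Fin n →₀ ℕ)) (hT : ∀ s ∈ T, (degRevLex n).toSyn t ≤ (degRevLex n).toSyn s)
    (w : T → MvPolynomial (Fin n) k) (hw : ∀ s, w s ∈ idealLE I t.degree)
    (hdet : (Matrix.of fun r s : T => coeff s.1 (w r)).det ≠ 0) :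
    T.card ≤ (leadExpsGE I t).ncard := by
  classical
  set V := Submodule.span k (Set.range w) with hV
  let Φ : MvPolynomial (Fin n) k →ₗ[k] T → k := LinearMap.pi fun s : T => lcoeff k s.1
  have hrows : LinearIndependent k (Φ ∘ w) := by
    refine Matrix.linearIndependent_rows_iff_isUnit
      (A := Matrix.of fun r s : T => coeff s.1 (w r)).2 ?_
    rw [Matrix.isUnit_iff_isUnit_det]
    exact hdet.isUnit
  have hli : LinearIndependent k w := LinearIndependent.of_comp Φ hrows
  have hVle : V ≤ idealLE I t.degree := by
    rw [hV, Submodule.span_le]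
    rintro _ ⟨s, rfl⟩
    exact hw s
  have hsub : leadExps (V : Set (MvPolynomial (Fin n) k)) ⊆ leadExpsGE I t := by
    rintro _ ⟨f, hf, h0, rfl⟩
    obtain ⟨hfI, hfd⟩ := mem_idealLE.1 (hVle hf)
    have hΦ : Φ f ≠ 0 := by
      obtain ⟨c, rfl⟩ := (Submodule.mem_span_range_iff_exists_fun k).1 hf
      intro h
      apply h0
      have hc := Fintype.linearIndependent_iff.1 hrows c (by simpa [map_sum, map_smul] using h)
      simp [hc]
    obtain ⟨s, hs⟩ := Function.ne_iff.1 hΦ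
    have hle := (hT s.1 s.2).trans (le_ltExp (f := f) hs)
    exact ⟨⟨f, hfI, h0, rfl⟩,
      le_antisymm (degree_ltExp f ▸ hfd) (degree_le_of_toSyn_le hle), hle⟩
  have hfin := finite_leadExpsGE I t
  have : FiniteDimensional k V := FiniteDimensional.span_of_finite k (Set.finite_range w)
  calc T.card = Fintype.card T := (Fintype.card_coe T).symm
    _ = Module.finrank k V := (finrank_span_eq_card hli).symm
    _ = (leadExps (V : Set (MvPolynomial (Fin n) k))).ncard :=
      (ncard_leadExps_eq_finrank V (hfin.subset hsub)).symm
    _ ≤ (leadExpsGE I t).ncard := Set.ncard_le_ncard hsub hfin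

/-! ### Shears -/

/-- The coordinate transformation `x_j ↦ x_j + a x_i`. -/
noncomputable def shear (i j : Fin n) (a : k) :
    MvPolynomial (Fin n) k →ₐ[k] MvPolynomial (Fin n) k :=
  aeval fun l => if l = j then X j + C a * X i else X l

theorem shear_X (i j : Fin n) (a : k) (l : Fin n) :
    shear i j a (X l) = if l = j then X j + C a * X i else X l := by
  simp [shear]

theorem shear_one (i j : Fin n) : shear i j (1 : k) = elementaryMove k i j := by
  simp [shear, elementaryMove]

theorem shear_zero (i j : Fin n) : shear i j (0 : k) = AlgHom.id k _ := by
  ext1 l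
  by_cases h : l = j <;> simp [shear_X, h]

theorem shear_comp_shear {i j : Fin n} (hij : i ≠ j) (a b : k) :
    (shear i j a).comp (shear i j b) = shear i j (a + b) := by
  ext1 l
  by_cases h : l = j
  · subst h
    simp only [AlgHom.comp_apply, shear_X, if_true, map_add, map_mul, if_neg hij,
      ← algebraMap_eq, AlgHom.commutes]
    ring
  · simp [shear_X, h]

theorem totalDegree_shear_le (i j : Fin n) (a : k) (f : MvPolynomial (Fin n) k) :
    (shear i j a f).totalDegree ≤ f.totalDegree := by
  conv_lhs => rw [f.as_sum, map_sum]
  refine totalDegree_finsetSum_le fun μ hμ => ?_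
  have hX : ∀ l, (shear i j a (X l)).totalDegree ≤ 1 := by
    intro l
    rw [shear_X]
    split_ifs
    · refine (totalDegree_add _ _).trans (max_le (by simp) ((totalDegree_mul _ _).trans ?_))
      simp
    · simp
  rw [monomial_eq, map_mul, ← algebraMap_eq, AlgHom.commutes, algebraMap_eq]
  refine (totalDegree_mul _ _).trans ?_
  rw [totalDegree_C, zero_add, Finsupp.prod, map_prod]
  refine (totalDegree_finsetProd _ _).trans (le_trans ?_ (le_totalDegree hμ))
  refine Finset.sum_le_sum fun l _ => ?_
  rw [map_pow]
  exact (totalDegree_pow _ _).trans (by simpa using Nat.mul_le_mul_left (μ l) (hX l))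

theorem shear_mem_idealLE {i j : Fin n} {a : k} {I : Ideal (MvPolynomial (Fin n) k)} {d : ℕ}
    {f : MvPolynomial (Fin n) k} (hf : f ∈ idealLE I d) :
    shear i j a f ∈ idealLE (I.map (shear i j a)) d := by
  rw [mem_idealLE] at hf ⊢
  exact ⟨Ideal.mem_map_of_mem _ hf.1, (totalDegree_shear_le i j a f).trans hf.2⟩

theorem map_shear_map_shear {i j : Fin n} (hij : i ≠ j) (a b : k)
    (I : Ideal (MvPolynomial (Fin n) k)) :
    (I.map (shear i j b)).map (shear i j a) = I.map (shear i j (a + b)) := by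
  rw [Ideal.map_mapₐ, shear_comp_shear hij]

theorem finrank_idealLE_le_map_shear {i j : Fin n} (hij : i ≠ j) (a : k)
    (I : Ideal (MvPolynomial (Fin n) k)) (d : ℕ) :
    Module.finrank k (idealLE I d) ≤ Module.finrank k (idealLE (I.map (shear i j a)) d) := by
  refine LinearMap.finrank_le_finrank_of_injective
    (f := (shear i j a).toLinearMap.restrict fun f hf => shear_mem_idealLE hf) ?_
  have hinv : ∀ f, shear i j (-a) (shear i j a f) = f := by
    intro f
    rw [← AlgHom.comp_apply, shear_comp_shear hij, neg_add_cancel, shear_zero, AlgHom.id_apply]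
  intro f g h
  have h' : shear i j a f.1 = shear i j a g.1 := congrArg Subtype.val h
  exact Subtype.ext (by rw [← hinv f.1, h', hinv])

/-- A shear does not change the Hilbert function of an ideal. -/
theorem finrank_idealLE_map_shear {i j : Fin n} (hij : i ≠ j) (a : k)
    (I : Ideal (MvPolynomial (Fin n) k)) (d : ℕ) :
    Module.finrank k (idealLE (I.map (shear i j a)) d) = Module.finrank k (idealLE I d) := by
  refine le_antisymm ?_ (finrank_idealLE_le_map_shear hij a I d)
  have h := finrank_idealLE_le_map_shear hij (-a) (I.map (shear i j a)) d
  rw [map_shear_map_shear hij, neg_add_cancel, shear_zero] at h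
  rwa [show I.map (AlgHom.id k (MvPolynomial (Fin n) k)) = I from Ideal.map_id I] at h

/-- The transformation `x_j ↦ x_j + T x_i`, where `T` is an indeterminate over the ground field. -/
noncomputable def genericShear (i j : Fin n) :
    MvPolynomial (Fin n) k →+* MvPolynomial (Fin n) (Polynomial k) :=
  eval₂Hom (C.comp Polynomial.C) fun l => if l = j then X j + C Polynomial.X * X i else X l

theorem coeff_shear (i j : Fin n) (a : k) (f : MvPolynomial (Fin n) k) (μ : Fin n →₀ ℕ) :
    coeff μ (shear i j a f) = (coeff μ (genericShear i j f)).eval a := by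
  have h : (shear i j a).toRingHom = (map (Polynomial.evalRingHom a)).comp (genericShear i j) := by
    apply MvPolynomial.ringHom_ext
    · intro r
      simp [genericShear, shear]
    · intro l
      by_cases hl : l = j <;> simp [genericShear, shear, hl]
  have h' := congrArg (coeff μ) (RingHom.congr_fun h f)
  simpa [coeff_map] using h'

/-- The first order expansion of the generic shear: its linear part is the derivation
`x_i ∂/∂x_j`. -/
theorem exists_genericShear_eq (i j : Fin n) (f : MvPolynomial (Fin n) k) :
    ∃ r, genericShear i j f = map Polynomial.C f +
      C Polynomial.X * map Polynomial.C (X i * pderiv j f) + C (Polynomial.X ^ 2) * r := by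
  induction f using MvPolynomial.induction_on with
  | C a => exact ⟨0, by simp [genericShear]⟩
  | add f g hf hg =>
    obtain ⟨r, hr⟩ := hf
    obtain ⟨s, hs⟩ := hg
    refine ⟨r + s, ?_⟩
    rw [map_add, hr, hs]
    simp only [map_add, mul_add]
    ring
  | mul_X f l hf =>
    obtain ⟨r, hr⟩ := hf
    by_cases hl : l = j
    · subst hl
      refine ⟨r * (X l + C Polynomial.X * X i) + map Polynomial.C (X i * pderiv l f) * X i, ?_⟩
      have hX : genericShear i l (X l : MvPolynomial (Fin n) k) =
          X l + C Polynomial.X * X i := by simp [genericShear]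
      rw [map_mul, hr, hX, Derivation.leibniz, pderiv_X_self]
      simp only [map_add, map_mul, map_X, smul_eq_mul, map_pow, mul_one]
      ring
    · refine ⟨r * X l, ?_⟩
      have hX : genericShear i j (X l : MvPolynomial (Fin n) k) = X l := by
        simp [genericShear, hl]
      rw [map_mul, hr, hX, Derivation.leibniz, pderiv_X_of_ne hl]
      simp only [map_mul, map_X, smul_eq_mul, mul_zero, zero_add]
      ring

theorem coeff_zero_coeff_genericShear (i j : Fin n) (f : MvPolynomial (Fin n) k)
    (μ : Fin n →₀ ℕ) : (coeff μ (genericShear i j f)).coeff 0 = coeff μ f := by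
  obtain ⟨r, hr⟩ := exists_genericShear_eq i j f
  rw [hr, coeff_add, coeff_add, coeff_C_mul, coeff_C_mul, coeff_map, coeff_map]
  simp

theorem coeff_one_coeff_genericShear (i j : Fin n) (f : MvPolynomial (Fin n) k)
    (μ : Fin n →₀ ℕ) :
    (coeff μ (genericShear i j f)).coeff 1 = coeff μ (X i * pderiv j f) := by
  obtain ⟨r, hr⟩ := exists_genericShear_eq i j f
  rw [hr, coeff_add, coeff_add, coeff_C_mul, coeff_C_mul, coeff_map, coeff_map]
  simp [Polynomial.coeff_X_pow_mul', Polynomial.coeff_C]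

/-! ### Leading terms after a generic shear -/

theorem exists_eq_moveTerm {i j : Fin n} {μ : Fin n →₀ ℕ} (hj : μ j ≠ 0) :
    ∃ ρ : Fin n →₀ ℕ, μ = ρ + Finsupp.single j 1 ∧ moveTerm i j μ = ρ + Finsupp.single i 1 := by
  have h : Finsupp.single j 1 ≤ μ := by
    rw [Finsupp.single_le_iff]
    omega
  exact ⟨μ - Finsupp.single j 1, (tsub_add_cancel_of_le h).symm, add_comm _ _⟩

theorem degree_moveTerm {i j : Fin n} {μ : Fin n →₀ ℕ} (hj : μ j ≠ 0) :
    (moveTerm i j μ).degree = μ.degree := by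
  obtain ⟨ρ, h, h'⟩ := exists_eq_moveTerm (i := i) hj
  rw [h', h]
  simp

theorem lt_moveTerm {i j : Fin n} (hij : i < j) {μ : Fin n →₀ ℕ} (hj : μ j ≠ 0) :
    (degRevLex n).toSyn μ < (degRevLex n).toSyn (moveTerm i j μ) := by
  refine degRevLex_lt_iff.2 (Or.inr ⟨(degree_moveTerm hj).symm, j, ?_, ?_⟩)
  · obtain ⟨ρ, h, h'⟩ := exists_eq_moveTerm (i := i) hj
    rw [h', h]
    simp [hij.ne]
  · intro l hl
    obtain ⟨ρ, h, h'⟩ := exists_eq_moveTerm (i := i) hj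
    rw [h', h]
    simp [hl.ne, (hij.trans hl).ne]

theorem coeff_X_mul_pderiv_moveTerm {i j : Fin n} {f : MvPolynomial (Fin n) k}
    {μ : Fin n →₀ ℕ} (hj : μ j ≠ 0) :
    coeff (moveTerm i j μ) (X i * pderiv j f) = coeff μ f * μ j := by
  obtain ⟨ρ, h, h'⟩ := exists_eq_moveTerm (i := i) hj
  rw [h', add_comm, coeff_X_mul, coeff_pderiv, ← h, h]
  simp

theorem coeff_X_mul_pderiv_eq_zero {i j : Fin n} {f : MvPolynomial (Fin n) k}
    (hj : ltExp f j ≠ 0) {ν : Fin n →₀ ℕ}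
    (hν : (degRevLex n).toSyn (moveTerm i j (ltExp f)) < (degRevLex n).toSyn ν) :
    coeff ν (X i * pderiv j f) = 0 := by
  classical
  rw [coeff_X_mul']
  split_ifs with h
  swap
  · rfl
  have hle : Finsupp.single i 1 ≤ ν := by
    rw [Finsupp.single_le_iff]
    have := Finsupp.mem_support_iff.1 h
    omega
  obtain ⟨ρ, rfl⟩ := exists_add_of_le hle
  obtain ⟨σ, hσ, hσ'⟩ := exists_eq_moveTerm (i := i) hj
  rw [add_tsub_cancel_left, coeff_pderiv, coeff_eq_zero_of_ltExp_lt, zero_mul]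
  rw [hσ', add_comm, map_add, map_add, add_lt_add_iff_left] at hν
  rw [hσ, map_add, map_add]
  exact add_lt_add_left hν _

/-- A row of coefficients, depending polynomially on `a`, of elements of degree at most `|t|` of the
transforms of `I` under `x_j ↦ x_j + a x_i` for `a ≠ 0`, such that the leading exponent in the limit
`a → 0` is `r`; only terms that are at least `x^t` are taken into account. -/
def IsLimitRow (i j : Fin n) (I : Ideal (MvPolynomial (Fin n) k)) (t r : Fin n →₀ ℕ)
    (c : (Fin n →₀ ℕ) → Polynomial k) : Prop :=
  (∀ s, (degRevLex n).toSyn r < (degRevLex n).toSyn s → (c s).eval 0 = 0) ∧ (c r).eval 0 ≠ 0 ∧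
    ∀ a ≠ 0, ∃ h ∈ idealLE (I.map (shear i j a)) t.degree,
      ∀ s, (degRevLex n).toSyn t ≤ (degRevLex n).toSyn s → coeff s h = (c s).eval a

/-- The determinant of the rows is a polynomial in `a`. It does not vanish at `a = 0`, since the
matrix is triangular there, so it vanishes for finitely many values of `a` only. -/
theorem finite_setOf_ncard_lt_card {i j : Fin n} {I : Ideal (MvPolynomial (Fin n) k)}
    {t : Fin n →₀ ℕ} (T : Finset (Fin n →₀ ℕ))
    (hT : ∀ s ∈ T, (degRevLex n).toSyn t ≤ (degRevLex n).toSyn s)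
    (hrow : ∀ r ∈ T, ∃ c, IsLimitRow i j I t r c) :
    {a : k | (leadExpsGE (I.map (shear i j a)) t).ncard < T.card}.Finite := by
  classical
  choose c hc0 hc1 hc using fun r : T => hrow r.1 r.2
  let M : Matrix T T (Polynomial k) := Matrix.of fun r s => c r s.1
  have heval : ∀ a : k, M.det.eval a = (Matrix.of fun r s : T => (c r s.1).eval a).det := by
    intro a
    rw [← Polynomial.coe_evalRingHom, RingHom.map_det]
    rfl
  have hM : M.det ≠ 0 := by
    intro h0
    have h1 := heval 0
    rw [h0, Polynomial.eval_zero] at h1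
    have hli : LinearIndependent k (Matrix.of fun r s : T => (c r s.1).eval 0).row :=
      linearIndependent_of_triangular (b := fun s : T => (degRevLex n).toSyn s.1)
        (φ := fun s => LinearMap.proj s)
        (fun a b h => Subtype.ext ((degRevLex n).toSyn.injective h))
        (fun r s h => hc0 r s.1 h) (fun r => hc1 r)
    rw [Matrix.linearIndependent_rows_iff_isUnit, Matrix.isUnit_iff_isUnit_det, ← h1] at hli
    exact not_isUnit_zero hli
  refine ((M.det.rootSet_finite k).insert 0).subset ?_
  intro a ha
  by_contra hcon
  rw [Set.mem_insert_iff, not_or, Polynomial.mem_rootSet, not_and] at hcon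
  choose h hh hcoeff using fun r => hc r a hcon.1
  refine absurd ha (not_lt.2 (card_le_ncard_leadExpsGE _ T hT h hh ?_))
  have hmat : (Matrix.of fun r s : T => coeff s.1 (h r)) =
      Matrix.of fun r s : T => (c r s.1).eval a := by
    ext r s
    exact hcoeff r s.1 (hT s.1 s.2)
  rw [hmat, ← heval]
  simpa using hcon.2 hM

theorem isLimitRow_of_mem {i j : Fin n} {I : Ideal (MvPolynomial (Fin n) k)} {t : Fin n →₀ ℕ}
    {f : MvPolynomial (Fin n) k} (hf : f ∈ idealLE I t.degree) (h0 : f ≠ 0) :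
    IsLimitRow i j I t (ltExp f) fun s => coeff s (genericShear i j f) := by
  refine ⟨fun s hs => ?_, ?_,
    fun a _ => ⟨_, shear_mem_idealLE hf, fun s _ => coeff_shear _ _ _ _ _⟩⟩
  · rw [← Polynomial.coeff_zero_eq_eval_zero, coeff_zero_coeff_genericShear]
    exact coeff_eq_zero_of_ltExp_lt hs
  · rw [← Polynomial.coeff_zero_eq_eval_zero, coeff_zero_coeff_genericShear]
    exact coeff_ltExp_ne_zero h0

/-- If `ψ` is the transformation `x_j ↦ x_j + a x_i`, the terms of `a⁻¹ ψ(g)` that are larger than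
the leading term of `g` tend for `a → 0` to the terms of `x_i ∂g/∂x_j`, with leading term
`x_i lt(g) / x_j`. -/
theorem isLimitRow_moveTerm [CharZero k] {i j : Fin n} (hij : i < j)
    {I : Ideal (MvPolynomial (Fin n) k)} {g : MvPolynomial (Fin n) k} (hg : g ∈ I) (h0 : g ≠ 0)
    (hj : ltExp g j ≠ 0) :
    IsLimitRow i j I (moveTerm i j (ltExp g)) (moveTerm i j (ltExp g))
      fun s => (coeff s (genericShear i j g)).divX := by
  have heval : ∀ p : Polynomial k, p.divX.eval 0 = p.coeff 1 := by
    intro p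
    rw [← Polynomial.coeff_zero_eq_eval_zero, Polynomial.coeff_divX]
  refine ⟨fun s hs => ?_, ?_, fun a ha => ⟨C a⁻¹ * shear i j a g, ?_, fun s hs => ?_⟩⟩
  · rw [heval, coeff_one_coeff_genericShear, coeff_X_mul_pderiv_eq_zero hj hs]
  · rw [heval, coeff_one_coeff_genericShear, coeff_X_mul_pderiv_moveTerm hj]
    exact mul_ne_zero (coeff_ltExp_ne_zero h0) (Nat.cast_ne_zero.2 hj)
  · rw [← smul_eq_C_mul]
    refine Submodule.smul_mem _ _ (shear_mem_idealLE (mem_idealLE.2 ⟨hg, ?_⟩))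
    rw [degree_moveTerm hj, degree_ltExp]
  · have hs0 : (coeff s (genericShear i j g)).coeff 0 = 0 := by
      rw [coeff_zero_coeff_genericShear]
      exact coeff_eq_zero_of_ltExp_lt ((lt_moveTerm hij hj).trans_le hs)
    have hp := Polynomial.X_mul_divX_add (coeff s (genericShear i j g))
    rw [hs0, Polynomial.C_0, add_zero] at hp
    rw [coeff_C_mul, coeff_shear]
    conv_lhs => rw [← hp]
    rw [Polynomial.eval_mul, Polynomial.eval_X, inv_mul_cancel_left₀ ha]

theorem exists_isLimitRow_of_mem_leadExpsGE (i j : Fin n) {I : Ideal (MvPolynomial (Fin n) k)}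
    {t r : Fin n →₀ ℕ} (hr : r ∈ leadExpsGE I t) : ∃ c, IsLimitRow i j I t r c := by
  obtain ⟨⟨f, hf, h0, rfl⟩, hd, -⟩ := hr
  exact ⟨_, isLimitRow_of_mem (mem_idealLE.2 ⟨hf, by rw [← degree_ltExp, hd]⟩) h0⟩

/-- A generic shear does not decrease the number of large leading terms. -/
theorem finite_setOf_ncard_leadExpsGE_lt (i j : Fin n) (I : Ideal (MvPolynomial (Fin n) k))
    (t : Fin n →₀ ℕ) :
    {a : k | (leadExpsGE (I.map (shear i j a)) t).ncard < (leadExpsGE I t).ncard}.Finite := by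
  rw [Set.ncard_eq_toFinset_card _ (finite_leadExpsGE I t)]
  refine finite_setOf_ncard_lt_card _ (fun s hs => ?_) fun r hr => ?_
  · exact ((Set.Finite.mem_toFinset _).1 hs).2.2
  · exact exists_isLimitRow_of_mem_leadExpsGE i j ((Set.Finite.mem_toFinset _).1 hr)

/-- At an obstruction to strong stability, a generic shear increases the number of large leading
terms. -/
theorem finite_setOf_ncard_leadExpsGE_moveTerm_le [CharZero k] {i j : Fin n} (hij : i < j)
    {I : Ideal (MvPolynomial (Fin n) k)} {g : MvPolynomial (Fin n) k} (hg : g ∈ I) (h0 : g ≠ 0)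
    (hj : ltExp g j ≠ 0)
    (hu : moveTerm i j (ltExp g) ∉ leadExps (I : Set (MvPolynomial (Fin n) k))) :
    {a : k | (leadExpsGE (I.map (shear i j a)) (moveTerm i j (ltExp g))).ncard ≤
      (leadExpsGE I (moveTerm i j (ltExp g))).ncard}.Finite := by
  classical
  set u := moveTerm i j (ltExp g) with hudef
  have hfin := finite_leadExpsGE I u
  have hnot : u ∉ hfin.toFinset := fun h => hu ((Set.Finite.mem_toFinset _).1 h).1
  have hcard : (insert u hfin.toFinset).card = (leadExpsGE I u).ncard + 1 := by
    rw [Finset.card_insert_of_notMem hnot, Set.ncard_eq_toFinset_card _ hfin]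
  have hmain := finite_setOf_ncard_lt_card (i := i) (j := j) (I := I) (t := u)
    (insert u hfin.toFinset) ?_ ?_
  · simpa only [hcard, Nat.lt_succ_iff] using hmain
  · intro s hs
    rcases Finset.mem_insert.1 hs with rfl | hs
    · exact le_rfl
    · exact ((Set.Finite.mem_toFinset _).1 hs).2.2
  · intro r hr
    rcases Finset.mem_insert.1 hr with rfl | hr
    · exact ⟨_, isLimitRow_moveTerm hij hg h0 hj⟩
    · exact exists_isLimitRow_of_mem_leadExpsGE i j ((Set.Finite.mem_toFinset _).1 hr)

/-! ### Reduced Gröbner bases -/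

/-- Division with remainder by a set of polynomials in the ideal `I`. -/
theorem exists_remainder {I : Ideal (MvPolynomial (Fin n) k)} {B : Set (MvPolynomial (Fin n) k)}
    (hB : ∀ b ∈ B, b ∈ I ∧ b ≠ 0) (f : MvPolynomial (Fin n) k) :
    ∃ r, f - r ∈ Ideal.span B ∧ ∀ μ, coeff μ r ≠ 0 → ∀ b ∈ B, ¬ ltExp b ≤ μ := by
  obtain ⟨q, r, hf, -, hr⟩ := (degRevLex n).div_set
    (fun b hb => ((degRevLex n).leadingCoeff_ne_zero_iff.2 (hB b hb).2).isUnit) f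
  refine ⟨r, ?_, fun μ hμ b hb => hr μ (mem_support_iff.2 hμ) b hb⟩
  rw [sub_eq_iff_eq_add.2 hf, Finsupp.linearCombination_apply]
  exact Ideal.sum_mem _ fun b _ => Ideal.mul_mem_left _ _ (Ideal.subset_span b.2)

theorem IsReducedGroebnerBasis.mem_leadExps_iff {G : Finset (MvPolynomial (Fin n) k)}
    {I : Ideal (MvPolynomial (Fin n) k)} (hG : IsReducedGroebnerBasis G I) {μ : Fin n →₀ ℕ} :
    μ ∈ leadExps (I : Set (MvPolynomial (Fin n) k)) ↔ ∃ g ∈ G, ltExp g ≤ μ := by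
  rw [← monomial_mem_leadingIdeal_iff, ← hG.ltSpan_eq, monomial_mem_ltSpan_iff]
  constructor
  · rintro ⟨ν, ⟨g, hg, -, rfl⟩, h⟩
    exact ⟨g, hg, h⟩
  · rintro ⟨g, hg, h⟩
    exact ⟨_, ⟨g, hg, hG.ne_zero g hg, rfl⟩, h⟩

theorem IsReducedGroebnerBasis.ltExp_eq_of_le {G : Finset (MvPolynomial (Fin n) k)}
    {I : Ideal (MvPolynomial (Fin n) k)} (hG : IsReducedGroebnerBasis G I)
    {g h : MvPolynomial (Fin n) k} (hg : g ∈ G) (hh : h ∈ G) (hle : ltExp g ≤ ltExp h) :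
    ltExp g = ltExp h := by
  by_contra hne
  exact hG.reduced h hh g hg (fun e => hne (e ▸ rfl)) _
    (mem_support_iff.2 (coeff_ltExp_ne_zero (hG.ne_zero h hh))) hle

theorem IsReducedGroebnerBasis.span_eq {G : Finset (MvPolynomial (Fin n) k)}
    {I : Ideal (MvPolynomial (Fin n) k)} (hG : IsReducedGroebnerBasis G I) :
    Ideal.span (G : Set (MvPolynomial (Fin n) k)) = I := by
  have hle : Ideal.span (G : Set (MvPolynomial (Fin n) k)) ≤ I := Ideal.span_le.2 hG.subset
  refine le_antisymm hle fun f hf => ?_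
  obtain ⟨r, hfr, hr⟩ := exists_remainder
    (B := (G : Set (MvPolynomial (Fin n) k))) (fun g hg => ⟨hG.subset g hg, hG.ne_zero g hg⟩) f
  have hrI : r ∈ I := by simpa using I.sub_mem hf (hle hfr)
  have hr0 : r = 0 := by
    by_contra h0
    obtain ⟨g, hg, hgr⟩ := hG.mem_leadExps_iff.1 (ltExp_mem_leadExps hrI h0)
    exact hr _ (coeff_ltExp_ne_zero h0) g hg hgr
  simpa [hr0] using hfr

/-- Every ideal has a reduced Gröbner basis: for every minimal leading exponent `μ` it contains the
difference of `x^μ` and the remainder of `x^μ` modulo the ideal. -/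
theorem exists_isReducedGroebnerBasis (I : Ideal (MvPolynomial (Fin n) k)) :
    ∃ G, IsReducedGroebnerBasis G I := by
  classical
  set E := leadExps (I : Set (MvPolynomial (Fin n) k)) with hE
  have hrem : ∀ μ : Fin n →₀ ℕ, Minimal (· ∈ E) μ →
      ∃ g ∈ I, g ≠ 0 ∧ ltExp g = μ ∧ coeff μ g = 1 ∧ ∀ ν, coeff ν g ≠ 0 → ν ∈ E → ν = μ := by
    intro μ hμ
    obtain ⟨r, hsub, hr⟩ := exists_remainder
      (B := {b : MvPolynomial (Fin n) k | b ∈ I ∧ b ≠ 0}) (fun b hb => hb) (monomial μ 1)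
    have hrE : ∀ ν ∈ E, coeff ν r = 0 := by
      rintro ν ⟨b, hb, hb0, rfl⟩
      by_contra h
      exact hr _ h b ⟨hb, hb0⟩ le_rfl
    have hgI : monomial μ 1 - r ∈ I :=
      Ideal.span_le.2 (fun b hb => hb.1 : {b : MvPolynomial (Fin n) k | b ∈ I ∧ b ≠ 0} ⊆ I) hsub
    have hco : coeff μ (monomial μ 1 - r) = 1 := by simp [hrE μ hμ.prop]
    have h0 : monomial μ 1 - r ≠ 0 := by
      intro h
      simp [h] at hco
    have hmem : ∀ ν, coeff ν (monomial μ 1 - r) ≠ 0 → ν ∈ E → ν = μ := by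
      intro ν hν hνE
      rw [coeff_sub, hrE ν hνE, sub_zero, coeff_monomial] at hν
      by_contra hne
      exact hν (if_neg (Ne.symm hne))
    exact ⟨_, hgI, h0, hmem _ (coeff_ltExp_ne_zero h0) ⟨_, hgI, h0, rfl⟩, hco, hmem⟩
  choose g hgI hg0 hgμ hg1 hgE using hrem
  have hfin : {μ | Minimal (· ∈ E) μ}.Finite :=
    WellQuasiOrderedLE.finite_of_isAntichain (setOfPred_minimal_antichain _)
  have : Fintype {μ | Minimal (· ∈ E) μ} := hfin.fintype
  refine ⟨Finset.univ.image fun μ : {μ | Minimal (· ∈ E) μ} => g μ.1 μ.2, ?_, ?_, ?_, ?_, ?_⟩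
  · intro f hf
    obtain ⟨μ, -, rfl⟩ := Finset.mem_image.1 hf
    exact hgI _ _
  · rw [leadingIdeal, ltSpan_eq_span_image, ltSpan_eq_span_image]
    apply le_antisymm
    · refine Ideal.span_mono (Set.image_mono ?_)
      rintro _ ⟨f, hf, h0, rfl⟩
      obtain ⟨μ, -, rfl⟩ := Finset.mem_image.1 hf
      exact ⟨_, hgI _ _, h0, rfl⟩
    · refine Ideal.span_le.2 ?_
      rintro _ ⟨μ, hμ, rfl⟩
      obtain ⟨ν, hνμ, hν⟩ := exists_minimal_le_of_wellFoundedLT (· ∈ E) μ hμ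
      refine mem_ideal_span_monomial_image.2 fun ξ hξ => ⟨ν, ?_, ?_⟩
      · exact ⟨g ν hν, Finset.mem_coe.2 (Finset.mem_image.2 ⟨⟨ν, hν⟩, Finset.mem_univ _, rfl⟩),
          hg0 ν hν, hgμ ν hν⟩
      · have : ξ = μ := by simpa [eq_comm] using support_monomial_subset hξ
        rw [this]
        exact hνμ
  · intro f hf
    obtain ⟨μ, -, rfl⟩ := Finset.mem_image.1 hf
    exact hg0 _ _
  · intro f hf
    obtain ⟨μ, -, rfl⟩ := Finset.mem_image.1 hf
    rw [hgμ, hg1]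
  · intro f hf h hh hne ν hν hle
    obtain ⟨μ, -, rfl⟩ := Finset.mem_image.1 hf
    obtain ⟨ξ, -, rfl⟩ := Finset.mem_image.1 hh
    rw [hgμ] at hle
    have hνE : ν ∈ E := leadExps_mono I ξ.2.prop hle
    have hνμ := hgE _ μ.2 ν (mem_support_iff.1 hν) hνE
    rw [hνμ] at hle
    have hξμ : ξ = μ := Subtype.ext (le_antisymm hle (μ.2.le_of_le ξ.2.prop hle))
    exact hne (by rw [hξμ])

theorem isMovedBasis_iff {i j : Fin n} {G G' : Finset (MvPolynomial (Fin n) k)}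
    {I : Ideal (MvPolynomial (Fin n) k)} (hG : IsReducedGroebnerBasis G I) :
    IsMovedBasis i j G G' ↔ IsReducedGroebnerBasis G' (I.map (elementaryMove k i j)) := by
  rw [IsMovedBasis, ← Ideal.map_span, hG.span_eq]

/-! ### Lists of leading terms -/

theorem lsLT_nil_left {t : List (Fin n →₀ ℕ)} : LsLT [] t ↔ t ≠ [] := by
  cases t <;> simp [LsLT]

theorem not_lsLT_nil_right {s : List (Fin n →₀ ℕ)} : ¬ LsLT s [] := by
  simp [LsLT]

theorem lsLT_cons_cons {a b : Fin n →₀ ℕ} {s t : List (Fin n →₀ ℕ)} :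
    LsLT (a :: s) (b :: t) ↔ RevLexLT a b ∨ a = b ∧ LsLT s t := by
  constructor
  · rintro (⟨j, hs, ht, heq, hlt⟩ | ⟨heq, hlen⟩)
    · cases j with
      | zero => exact Or.inl hlt
      | succ j =>
        exact Or.inr ⟨heq 0 (Nat.succ_pos j), Or.inl ⟨j, Nat.lt_of_succ_lt_succ hs,
          Nat.lt_of_succ_lt_succ ht, fun i hi => heq (i + 1) (Nat.succ_lt_succ hi), hlt⟩⟩
    · exact Or.inr ⟨heq 0 (Nat.succ_pos _) (Nat.succ_pos _), Or.inr
        ⟨fun j hs ht => heq (j + 1) (Nat.succ_lt_succ hs) (Nat.succ_lt_succ ht),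
          Nat.lt_of_succ_lt_succ hlen⟩⟩
  · rintro (h | ⟨rfl, ⟨j, hs, ht, heq, hlt⟩ | ⟨heq, hlen⟩⟩)
    · exact Or.inl ⟨0, Nat.succ_pos _, Nat.succ_pos _, fun i hi => absurd hi (Nat.not_lt_zero i), h⟩
    · refine Or.inl ⟨j + 1, Nat.succ_lt_succ hs, Nat.succ_lt_succ ht, fun i hi => ?_, hlt⟩
      cases i with
      | zero => rfl
      | succ i => exact heq i (Nat.lt_of_succ_lt_succ hi)
    · refine Or.inr ⟨fun j hs ht => ?_, Nat.succ_lt_succ hlen⟩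
      cases j with
      | zero => rfl
      | succ j => exact heq j (Nat.lt_of_succ_lt_succ hs) (Nat.lt_of_succ_lt_succ ht)

theorem LsLT.irrefl (s : List (Fin n →₀ ℕ)) : ¬ LsLT s s := by
  induction s with
  | nil => exact not_lsLT_nil_right
  | cons a s ih =>
    rw [lsLT_cons_cons]
    rintro (h | ⟨-, h⟩)
    · exact RevLexLT.irrefl a h
    · exact ih h

theorem LsLT.trans {s t u : List (Fin n →₀ ℕ)} (h : LsLT s t) (h' : LsLT t u) : LsLT s u := by
  induction s generalizing t u with
  | nil =>
    cases u with
    | nil => exact absurd h' not_lsLT_nil_right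
    | cons c u => exact lsLT_nil_left.2 (List.cons_ne_nil _ _)
  | cons a s ih =>
    cases t with
    | nil => exact absurd h not_lsLT_nil_right
    | cons b t =>
      cases u with
      | nil => exact absurd h' not_lsLT_nil_right
      | cons c u =>
        rw [lsLT_cons_cons] at h h' ⊢
        rcases h with h | ⟨rfl, h⟩ <;> rcases h' with h' | ⟨rfl, h'⟩
        · exact Or.inl (h.trans h')
        · exact Or.inl h
        · exact Or.inl h'
        · exact Or.inr ⟨rfl, ih h h'⟩

theorem LsLT.trichotomous (s t : List (Fin n →₀ ℕ)) : LsLT s t ∨ s = t ∨ LsLT t s := by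
  induction s generalizing t with
  | nil => cases t <;> simp [lsLT_nil_left]
  | cons a s ih =>
    cases t with
    | nil => simp [lsLT_nil_left]
    | cons b t =>
      rw [lsLT_cons_cons, lsLT_cons_cons, List.cons.injEq]
      rcases RevLexLT.trichotomous a b with h | rfl | h
      · exact Or.inl (Or.inl h)
      · rcases ih t with h | rfl | h
        · exact Or.inl (Or.inr ⟨rfl, h⟩)
        · exact Or.inr (Or.inl ⟨rfl, rfl⟩)
        · exact Or.inr (Or.inr (Or.inr ⟨rfl, h⟩))
      · exact Or.inr (Or.inr (Or.inl h))

theorem lsLT_of_not_lsLE {s t : List (Fin n →₀ ℕ)} (h : ¬ LsLE s t) : LsLT t s := by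
  rcases LsLT.trichotomous s t with h' | h' | h'
  · exact absurd (Or.inl h') h
  · exact absurd (Or.inr h') h
  · exact h'

theorem not_lsLE_of_lsLT {s t : List (Fin n →₀ ℕ)} (h : LsLT t s) : ¬ LsLE s t := by
  rintro (h' | rfl)
  · exact LsLT.irrefl _ (h.trans h')
  · exact LsLT.irrefl _ h

/-- If a descending list is larger than another one, then the largest term by which they differ
belongs to it. -/
theorem LsLT.exists_mem_notMem {s t : List (Fin n →₀ ℕ)} (h : LsLT s t)
    (hs : s.Pairwise fun a b => RevLexLT b a) (ht : t.Pairwise fun a b => RevLexLT b a) :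
    ∃ τ ∈ t, τ ∉ s ∧ ∀ μ ∈ s, RevLexLT τ μ → μ ∈ t := by
  induction s generalizing t with
  | nil =>
    obtain ⟨τ, hτ⟩ := List.exists_mem_of_ne_nil t (lsLT_nil_left.1 h)
    exact ⟨τ, hτ, List.not_mem_nil, fun μ hμ => absurd hμ List.not_mem_nil⟩
  | cons a s ih =>
    cases t with
    | nil => exact absurd h not_lsLT_nil_right
    | cons b t =>
      rw [List.pairwise_cons] at hs ht
      rcases lsLT_cons_cons.1 h with hab | ⟨rfl, hst⟩
      · have hlt : ∀ μ ∈ a :: s, RevLexLT μ b := by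
          intro μ hμ
          rcases List.mem_cons.1 hμ with rfl | hμ
          · exact hab
          · exact (hs.1 μ hμ).trans hab
        exact ⟨b, List.mem_cons_self, fun hb => RevLexLT.irrefl _ (hlt b hb),
          fun μ hμ hbμ => absurd ((hlt μ hμ).trans hbμ) (RevLexLT.irrefl _)⟩
      · obtain ⟨τ, hτ, hτs, hτμ⟩ := ih hst hs.2 ht.2
        refine ⟨τ, List.mem_cons_of_mem _ hτ, ?_, ?_⟩
        · intro hmem
          rcases List.mem_cons.1 hmem with rfl | hmem
          · exact RevLexLT.irrefl _ (ht.1 _ hτ)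
          · exact hτs hmem
        · intro μ hμ hlt
          rcases List.mem_cons.1 hμ with rfl | hμ
          · exact List.mem_cons_self
          · exact List.mem_cons_of_mem _ (hτμ μ hμ hlt)

theorem mem_ls {G : Finset (MvPolynomial (Fin n) k)} {μ : Fin n →₀ ℕ} :
    μ ∈ ls G ↔ ∃ g ∈ G, ltExp g = μ := by
  simp [ls, Finset.mem_sort]

theorem pairwise_ls (G : Finset (MvPolynomial (Fin n) k)) :
    (ls G).Pairwise fun a b => RevLexLT b a := by
  classical
  refine ((Finset.pairwise_sort (G.image ltExp) RevLexGE).and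
    (Finset.sort_nodup (G.image ltExp) RevLexGE)).imp ?_
  rintro a b ⟨h | h, hne⟩
  · exact absurd h hne
  · exact h

theorem ls_eq_ls {G G' : Finset (MvPolynomial (Fin n) k)} (h : ∀ μ, μ ∈ ls G ↔ μ ∈ ls G') :
    ls G = ls G' := by
  classical
  have : G.image ltExp = G'.image ltExp := by
    ext μ
    simpa [mem_ls] using h μ
  unfold ls
  rw [this]

/-- The list of leading terms of a reduced Gröbner basis depends only on the leading ideal. -/
theorem ls_eq_ls_of_leadExps_eq {G G' : Finset (MvPolynomial (Fin n) k)}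
    {I I' : Ideal (MvPolynomial (Fin n) k)} (hG : IsReducedGroebnerBasis G I)
    (hG' : IsReducedGroebnerBasis G' I')
    (h : leadExps (I : Set (MvPolynomial (Fin n) k)) =
      leadExps (I' : Set (MvPolynomial (Fin n) k))) :
    ls G = ls G' := by
  have key : ∀ {G G' : Finset (MvPolynomial (Fin n) k)} {I I' : Ideal (MvPolynomial (Fin n) k)},
      IsReducedGroebnerBasis G I → IsReducedGroebnerBasis G' I' →
      leadExps (I : Set (MvPolynomial (Fin n) k)) = leadExps (I' : Set (MvPolynomial (Fin n) k)) →
      ∀ μ ∈ ls G, μ ∈ ls G' := by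
    intro G G' I I' hG hG' h μ hμ
    obtain ⟨g, hg, rfl⟩ := mem_ls.1 hμ
    obtain ⟨g', hg', hle'⟩ := hG'.mem_leadExps_iff.1 (h ▸ hG.mem_leadExps_iff.2 ⟨g, hg, le_rfl⟩)
    obtain ⟨g'', hg'', hle''⟩ :=
      hG.mem_leadExps_iff.1 (h ▸ hG'.mem_leadExps_iff.2 ⟨g', hg', le_rfl⟩)
    have heq := hG.ltExp_eq_of_le hg'' hg (hle''.trans hle')
    exact mem_ls.2 ⟨g', hg', le_antisymm hle' (heq ▸ hle'')⟩
  exact ls_eq_ls fun μ => ⟨key hG hG' h μ, key hG' hG h.symm μ⟩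

theorem revLexLT_of_le_of_ne {μ ν : Fin n →₀ ℕ} (h : μ ≤ ν) (hne : μ ≠ ν) : RevLexLT ν μ := by
  rcases RevLexLT.trichotomous μ ν with ⟨i, hi, -⟩ | h' | h'
  · exact absurd (h i) (not_le.2 hi)
  · exact absurd h' hne
  · exact h'

/-- Suppose that an ideal `I'` has at least as many large leading terms as `I` in the degree of each
leading term of `G`. Then the list for `G'` cannot be the smaller one: the pure reverse
lexicographic order is anti-monotone for divisibility, so that at the first difference `τ` all large
leading terms of `I'` would be leading terms of `I` different from `τ`. -/
theorem not_lsLT_of_ncard_leadExpsGE_le {G G' : Finset (MvPolynomial (Fin n) k)}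
    {I I' : Ideal (MvPolynomial (Fin n) k)} (hG : IsReducedGroebnerBasis G I)
    (hG' : IsReducedGroebnerBasis G' I')
    (h : ∀ g ∈ G, (leadExpsGE I (ltExp g)).ncard ≤ (leadExpsGE I' (ltExp g)).ncard) :
    ¬ LsLT (ls G') (ls G) := by
  intro hlt
  obtain ⟨τ, hτ, hτ', hmem⟩ := hlt.exists_mem_notMem (pairwise_ls G') (pairwise_ls G)
  obtain ⟨g, hg, rfl⟩ := mem_ls.1 hτ
  -- a leading term of `G'` dividing a term `x^μ` that is at least `lt g` is larger than `lt g`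
  have hdiv : ∀ μ, μ.degree = (ltExp g).degree →
      (degRevLex n).toSyn (ltExp g) ≤ (degRevLex n).toSyn μ →
      ∀ g' ∈ G', ltExp g' ≤ μ → ∃ f ∈ G, ltExp f = ltExp g' := by
    intro μ hd hle g' hg' hg'μ
    refine mem_ls.1 (hmem _ (mem_ls.2 ⟨g', hg', rfl⟩) ?_)
    have hne : ltExp g' ≠ ltExp g := fun e => hτ' (mem_ls.2 ⟨g', hg', e⟩)
    have hgμ : ltExp g = μ ∨ RevLexLT (ltExp g) μ := by
      rcases hle.eq_or_lt with e | hlt'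
      · exact Or.inl ((degRevLex n).toSyn.injective e)
      · rcases degRevLex_lt_iff.1 hlt' with hlt' | hlt'
        · omega
        · exact Or.inr hlt'.2
    by_cases he : ltExp g' = μ
    · rw [he]
      exact hgμ.resolve_left fun e => hne (he.trans e.symm)
    · have h1 := revLexLT_of_le_of_ne hg'μ he
      rcases hgμ with e | h2
      · exact e ▸ h1
      · exact h2.trans h1
  refine absurd (h g hg) (not_le.2 (Set.ncard_lt_ncard ?_ (finite_leadExpsGE I _)))
  refine (Set.ssubset_iff_of_subset ?_).2 ⟨ltExp g,
    ⟨ltExp_mem_leadExps (hG.subset g hg) (hG.ne_zero g hg), rfl, le_rfl⟩, ?_⟩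
  · rintro μ ⟨hμ, hd, hle⟩
    obtain ⟨g', hg', hg'μ⟩ := hG'.mem_leadExps_iff.1 hμ
    obtain ⟨f, hf, hfg'⟩ := hdiv μ hd hle g' hg' hg'μ
    exact ⟨hG.mem_leadExps_iff.2 ⟨f, hf, hfg' ▸ hg'μ⟩, hd, hle⟩
  · rintro ⟨hμ, -, -⟩
    obtain ⟨g', hg', hle⟩ := hG'.mem_leadExps_iff.1 hμ
    obtain ⟨f, hf, hfg'⟩ := hdiv _ rfl le_rfl g' hg' hle
    have heq := hG.ltExp_eq_of_le hf hg (hfg' ▸ hle)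
    exact hτ' (mem_ls.2 ⟨g', hg', hfg' ▸ heq⟩)

/-- At an obstruction `(g, i, j)`, some power of `x_j ↦ x_j + x_i` increases the list of leading
terms. -/
theorem exists_lsLT_of_isObstruction [CharZero k] {G : Finset (MvPolynomial (Fin n) k)}
    {I : Ideal (MvPolynomial (Fin n) k)} (hG : IsReducedGroebnerBasis G I)
    {g : MvPolynomial (Fin n) k} {i j : Fin n} (hobs : IsObstruction G g i j) :
    ∃ m : ℕ, 1 ≤ m ∧ ∀ G', IsReducedGroebnerBasis G' (I.map (shear i j (m : k))) →
      LsLT (ls G) (ls G') := by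
  obtain ⟨hg, hij, hj, hu⟩ := hobs
  have hu' : moveTerm i j (ltExp g) ∉ leadExps (I : Set (MvPolynomial (Fin n) k)) := by
    rwa [hG.ltSpan_eq, monomial_mem_leadingIdeal_iff] at hu
  -- only finitely many scalars are bad, so in characteristic zero some positive integer is good
  have hbad := ((Finset.finite_toSet G).biUnion fun f _ =>
    finite_setOf_ncard_leadExpsGE_lt i j I (ltExp f)).union
    (finite_setOf_ncard_leadExpsGE_moveTerm_le hij (hG.subset g hg) (hG.ne_zero g hg) hj hu')
  obtain ⟨m, hm⟩ := ((hbad.preimage Nat.cast_injective.injOn).insert (0 : ℕ)).exists_notMem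
  rw [Set.mem_insert_iff, not_or, Set.mem_preimage, Set.mem_union, not_or] at hm
  obtain ⟨hm0, hm1, hm2⟩ := hm
  refine ⟨m, Nat.one_le_iff_ne_zero.2 hm0, fun G' hG' => ?_⟩
  rcases LsLT.trichotomous (ls G) (ls G') with h | h | h
  · exact h
  · -- equal lists would give equal leading ideals, contradicting the strict increase at `moveTerm`
    exfalso
    apply hm2
    have heq : leadExps (I : Set (MvPolynomial (Fin n) k)) =
        leadExps (I.map (shear i j (m : k)) : Set (MvPolynomial (Fin n) k)) := by
      ext μ
      have hls : ∀ {F : Finset (MvPolynomial (Fin n) k)},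
          (∃ f ∈ F, ltExp f ≤ μ) ↔ ∃ ν ∈ ls F, ν ≤ μ := by
        simp [mem_ls]
      rw [hG.mem_leadExps_iff, hG'.mem_leadExps_iff, hls, hls, h]
    simp only [Set.mem_ofPred_eq, leadExpsGE, heq, le_refl]
  · refine absurd h (not_lsLT_of_ncard_leadExpsGE_le hG hG' fun f hf => ?_)
    by_contra hcon
    exact hm1 (Set.mem_biUnion (Finset.mem_coe.2 hf) (not_le.1 hcon))

/-! ### Finiteness of the leading ideals with a given Hilbert function -/

/-- Among infinitely many ideals with the same Hilbert function two have the same leading ideal.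
The limit of the sets of leading exponents along an ultrafilter is an upper set. By Dickson's lemma
it is finitely generated, so that it is contained in most of the sets; it has the same Hilbert
function and is therefore equal to them. -/
theorem exists_lt_leadExps_eq (I : ℕ → Ideal (MvPolynomial (Fin n) k)) (H : ℕ → ℕ)
    (hH : ∀ m d, Module.finrank k (idealLE (I m) d) = H d) :
    ∃ m m', m < m' ∧ leadExps (I m : Set (MvPolynomial (Fin n) k)) =
      leadExps (I m' : Set (MvPolynomial (Fin n) k)) := by
  let U := Filter.hyperfilter ℕ
  let J : ℕ → Set (Fin n →₀ ℕ) := fun m => leadExps (I m : Set (MvPolynomial (Fin n) k))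
  have hJ : ∀ m d, {μ ∈ J m | μ.degree ≤ d}.ncard = H d := fun m d => by
    rw [← hH m d, ← ncard_leadExps_degree_le]
  let L : Set (Fin n →₀ ℕ) := {μ | ∀ᶠ m in U, μ ∈ J m}
  -- only finitely many terms matter in each degree, so `L` agrees there with some `J m`
  have hL : ∀ d, {μ ∈ L | μ.degree ≤ d}.ncard = H d := by
    intro d
    have hev : ∀ᶠ m in U, ∀ μ ∈ {μ : Fin n →₀ ℕ | μ.degree ≤ d}, (μ ∈ J m ↔ μ ∈ L) := by
      refine (Filter.eventually_all_finite (Finsupp.finite_of_degree_le d)).2 fun μ _ => ?_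
      by_cases hμ : μ ∈ L
      · exact hμ.mono fun m hm => ⟨fun _ => hμ, fun _ => hm⟩
      · exact (Ultrafilter.eventually_not.2 hμ).mono fun m hm =>
          ⟨fun h => absurd h hm, fun h => absurd h hμ⟩
    obtain ⟨m, hm⟩ := hev.exists
    rw [← hJ m d]
    congr 1
    ext μ
    exact and_congr_left fun hμ => (hm μ hμ).symm
  have hmin : {μ | Minimal (· ∈ L) μ}.Finite :=
    WellQuasiOrderedLE.finite_of_isAntichain (setOfPred_minimal_antichain _)
  have hev : ∀ᶠ m in U, J m = L := by
    have hgen : ∀ᶠ m in U, ∀ μ ∈ {μ | Minimal (· ∈ L) μ}, μ ∈ J m :=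
      (Filter.eventually_all_finite hmin).2 fun μ hμ => hμ.prop
    refine hgen.mono fun m hm => ?_
    have hsub : L ⊆ J m := by
      intro μ hμ
      obtain ⟨ν, hνμ, hν⟩ := exists_minimal_le_of_wellFoundedLT (· ∈ L) μ hμ
      exact leadExps_mono (I m) (hm ν hν) hνμ
    refine Set.Subset.antisymm (fun μ hμ => ?_) hsub
    have heq : {ν ∈ L | ν.degree ≤ μ.degree} = {ν ∈ J m | ν.degree ≤ μ.degree} :=
      Set.eq_of_subset_of_ncard_le (fun ν hν => ⟨hsub hν.1, hν.2⟩) (by rw [hL, hJ])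
        ((Finsupp.finite_of_degree_le μ.degree).subset fun ν hν => hν.2)
    have hmem : μ ∈ {ν ∈ J m | ν.degree ≤ μ.degree} := ⟨hμ, le_rfl⟩
    rw [← heq] at hmem
    exact hmem.1
  obtain ⟨m, hm⟩ := hev.exists
  obtain ⟨m', hm', hlt⟩ :=
    (hev.and (Nat.hyperfilter_le_atTop (Filter.eventually_gt_atTop m))).exists
  exact ⟨m, m', hlt, hm.trans hm'.symm⟩

/-! ### Termination -/

/-- `G'` and `G` are reduced Gröbner bases of ideals with the same Hilbert function, and the list of
leading terms of `G'` is larger. -/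
def IsProgress (G' G : Finset (MvPolynomial (Fin n) k)) : Prop :=
  LsLT (ls G) (ls G') ∧
    IsReducedGroebnerBasis G (Ideal.span G) ∧ IsReducedGroebnerBasis G' (Ideal.span G') ∧
    ∀ d, Module.finrank k (idealLE (Ideal.span (G' : Set (MvPolynomial (Fin n) k))) d) =
      Module.finrank k (idealLE (Ideal.span (G : Set (MvPolynomial (Fin n) k))) d)

theorem wellFounded_isProgress :
    WellFounded (IsProgress : Finset (MvPolynomial (Fin n) k) → _ → Prop) := by
  refine wellFounded_iff_isEmpty_descending_chain.2 ⟨?_⟩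
  rintro ⟨G, hG⟩
  have hH : ∀ m d, Module.finrank k (idealLE (Ideal.span (G m : Set (MvPolynomial (Fin n) k))) d) =
      Module.finrank k (idealLE (Ideal.span (G 0 : Set (MvPolynomial (Fin n) k))) d) := by
    intro m d
    induction m with
    | zero => rfl
    | succ m ih => rw [(hG m).2.2.2 d, ih]
  obtain ⟨m, m', hlt, heq⟩ := exists_lt_leadExps_eq _ _ hH
  have hls : ∀ q, LsLT (ls (G m)) (ls (G (m + q + 1))) := by
    intro q
    induction q with
    | zero => exact (hG m).1
    | succ q ih => exact ih.trans (hG (m + q + 1)).1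
  obtain ⟨q, rfl⟩ := Nat.exists_eq_add_of_lt hlt
  have h := hls q
  rw [ls_eq_ls_of_leadExps_eq (hG m).2.1 (hG (m + q + 1)).2.1 heq] at h
  exact LsLT.irrefl _ h

theorem acc_returned (Ψ : MvPolynomial (Fin n) k →ₐ[k] MvPolynomial (Fin n) k) :
    Acc (flip Step) (Config.returned Ψ) :=
  ⟨_, fun _ h => nomatch h⟩

/-- No infinite run starts at a configuration of the outer loop. -/
theorem acc_outer [CharZero k] (G : Finset (MvPolynomial (Fin n) k)) :
    ∀ (I : Ideal (MvPolynomial (Fin n) k)), IsReducedGroebnerBasis G I →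
      ∀ Ψ, Acc (flip Step) (Config.outer Ψ G) := by
  induction G using wellFounded_isProgress.induction with
  | h G ih =>
  intro I hG Ψ
  refine ⟨_, fun c hc => ?_⟩
  cases hc with
  | finish _ => exact acc_returned Ψ
  | enter hobs hGt =>
    rename_i Gt g i j
    have hij : i ≠ j := hobs.2.1.ne
    obtain ⟨M, hM1, hM⟩ := exists_lsLT_of_isObstruction hG hobs
    -- the inner loop ends after `M` applications of the elementary move at the latest
    have hinner : ∀ (q m : ℕ), m + q = M → ∀ Ψ Gt,
        IsReducedGroebnerBasis Gt (I.map (shear i j (m : k))) →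
          Acc (flip Step) (Config.inner Ψ i j G Gt) := by
      intro q
      induction q with
      | zero =>
        intro m hm Ψ Gt hGt
        have hlt := hM Gt (by rwa [← hm])
        refine ⟨_, fun c hc => ?_⟩
        cases hc with
        | again hguard _ => exact absurd hguard (not_lsLE_of_lsLT hlt)
        | leave hguard =>
          refine ih Gt ⟨hlt, hG.span_eq.symm ▸ hG, hGt.span_eq.symm ▸ hGt, fun d => ?_⟩ _ hGt Ψ
          rw [hG.span_eq, hGt.span_eq, finrank_idealLE_map_shear hij]
      | succ q ihq =>
        intro m hm Ψ Gt hGt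
        refine ⟨_, fun c hc => ?_⟩
        cases hc with
        | again hguard hGt' =>
          refine ihq (m + 1) (by omega) _ _ ?_
          rw [isMovedBasis_iff hGt, ← shear_one, map_shear_map_shear hij] at hGt'
          rwa [Nat.cast_add, Nat.cast_one, add_comm]
        | leave hguard =>
          refine ih Gt ⟨lsLT_of_not_lsLE hguard, hG.span_eq.symm ▸ hG, hGt.span_eq.symm ▸ hGt,
            fun d => ?_⟩ _ hGt Ψ
          rw [hG.span_eq, hGt.span_eq, finrank_idealLE_map_shear hij]
    refine hinner (M - 1) 1 (by omega) _ _ ?_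
    rwa [Nat.cast_one, shear_one, ← isMovedBasis_iff hG]

theorem not_exists_run_of_acc {c : Config k n} (h : Acc (flip Step) c) :
    ¬ ∃ run : ℕ → Config k n, run 0 = c ∧ ∀ t, Step (run t) (run (t + 1)) := by
  induction h with
  | intro c _ ih =>
    rintro ⟨run, rfl, hrun⟩
    exact ih (run 1) (hrun 0) ⟨fun t => run (t + 1), rfl, fun t => hrun (t + 1)⟩

/-! ### The returned transformation -/

/-- `Ψ` is a product of elementary moves `x_j ↦ x_j + x_i` with `i < j`. -/
def IsProductOfMoves (Ψ : MvPolynomial (Fin n) k →ₐ[k] MvPolynomial (Fin n) k) : Prop :=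
  ∃ L : List (Fin n × Fin n), (∀ p ∈ L, p.1 < p.2) ∧
    Ψ = (L.map fun p => elementaryMove k p.1 p.2).prod

theorem IsProductOfMoves.comp {Ψ : MvPolynomial (Fin n) k →ₐ[k] MvPolynomial (Fin n) k}
    (h : IsProductOfMoves Ψ) {i j : Fin n} (hij : i < j) :
    IsProductOfMoves ((elementaryMove k i j).comp Ψ) := by
  obtain ⟨L, hL, rfl⟩ := h
  refine ⟨(i, j) :: L, ?_, by rw [List.map_cons, List.prod_cons]; rfl⟩
  intro p hp
  rcases List.mem_cons.1 hp with rfl | hp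
  · exact hij
  · exact hL p hp

theorem linearChange_X (A : GL (Fin n) k) (r : Fin n) :
    linearChange A (X r) = ∑ s, C ((A : Matrix (Fin n) (Fin n) k) r s) * X s := by
  simp [linearChange]

theorem linearChange_one : linearChange (1 : GL (Fin n) k) = AlgHom.id k _ := by
  ext1 r
  simp [linearChange_X, Matrix.one_apply]

theorem linearChange_comp_linearChange (A B : GL (Fin n) k) :
    (linearChange A).comp (linearChange B) = linearChange (B * A) := by
  ext1 r
  simp only [AlgHom.comp_apply, linearChange_X, map_sum, map_mul, ← algebraMap_eq,
    AlgHom.commutes, Units.val_mul, Matrix.mul_apply, Finset.mul_sum, Finset.sum_mul]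
  rw [Finset.sum_comm]
  simp only [mul_assoc]

theorem exists_elementaryMove_eq_linearChange {i j : Fin n} (hij : i ≠ j) :
    ∃ A : GL (Fin n) k, elementaryMove k i j = linearChange A := by
  refine ⟨Matrix.GeneralLinearGroup.mk'' (Matrix.transvection j i 1) ?_, ?_⟩
  · rw [Matrix.det_transvection_of_ne j i hij.symm]
    exact isUnit_one
  · ext1 r
    rw [linearChange_X, ← shear_one, shear_X]
    have hA : ((Matrix.GeneralLinearGroup.mk'' (Matrix.transvection j i (1 : k))
        (by rw [Matrix.det_transvection_of_ne j i hij.symm]; exact isUnit_one) : GL (Fin n) k) :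
        Matrix (Fin n) (Fin n) k) = Matrix.transvection j i 1 := rfl
    rw [hA]
    by_cases hr : r = j
    · subst hr
      simp [Matrix.transvection, Matrix.one_apply, Matrix.single_apply, add_mul,
        Finset.sum_add_distrib]
    · simp [Matrix.transvection, Matrix.one_apply, hr, Ne.symm hr]

theorem IsProductOfMoves.exists_eq_linearChange
    {Ψ : MvPolynomial (Fin n) k →ₐ[k] MvPolynomial (Fin n) k} (h : IsProductOfMoves Ψ) :
    ∃ A : GL (Fin n) k, Ψ = linearChange A := by
  obtain ⟨L, hL, rfl⟩ := h
  induction L with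
  | nil => exact ⟨1, linearChange_one.symm⟩
  | cons p L ih =>
    obtain ⟨A, hA⟩ := ih fun q hq => hL q (List.mem_cons_of_mem _ hq)
    obtain ⟨B, hB⟩ := exists_elementaryMove_eq_linearChange (k := k) (hL p List.mem_cons_self).ne
    refine ⟨A * B, ?_⟩
    rw [List.map_cons, List.prod_cons, hA, hB, ← linearChange_comp_linearChange]
    rfl

/-- Strong stability can be tested on the leading terms of a Gröbner basis. -/
theorem inStronglyStablePosition_of_forall_not_isObstruction {G : Finset (MvPolynomial (Fin n) k)}
    {I : Ideal (MvPolynomial (Fin n) k)} (hG : IsReducedGroebnerBasis G I)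
    (hobs : ¬ ∃ g i j, IsObstruction G g i j) : InStronglyStablePosition I := by
  refine ⟨⟨_, ltSpan_eq_span_image _⟩, fun μ hμ i j hij hj => ?_⟩
  rw [monomial_mem_leadingIdeal_iff] at hμ ⊢
  obtain ⟨g, hg, hle⟩ := hG.mem_leadExps_iff.1 hμ
  obtain ⟨ρ, rfl⟩ := exists_add_of_le hle
  by_cases hgj : ltExp g j = 0
  · have hρj : ρ j ≠ 0 := by simpa [hgj] using hj
    obtain ⟨σ, hσ, -⟩ := exists_eq_moveTerm (i := i) hρj
    refine hG.mem_leadExps_iff.2 ⟨g, hg, ?_⟩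
    rw [moveTerm, hσ, ← add_assoc, add_tsub_cancel_right]
    exact le_add_left (self_le_add_right _ _)
  · have hmem : moveTerm i j (ltExp g) ∈ leadExps (I : Set (MvPolynomial (Fin n) k)) := by
      by_contra hcon
      refine hobs ⟨g, i, j, hg, hij, hgj, ?_⟩
      rwa [hG.ltSpan_eq, monomial_mem_leadingIdeal_iff]
    refine leadExps_mono I hmem ?_
    obtain ⟨σ, hσ, hσ'⟩ := exists_eq_moveTerm (i := i) hgj
    rw [hσ', moveTerm, hσ, add_right_comm, add_tsub_cancel_right, add_comm]
    exact add_le_add le_rfl (self_le_add_right _ _)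

/-- What holds for every configuration that the algorithm reaches on input of a Gröbner basis
of `I`. -/
def Config.Invariant (I : Ideal (MvPolynomial (Fin n) k)) : Config k n → Prop
  | .outer Ψ G => IsProductOfMoves Ψ ∧ IsReducedGroebnerBasis G (I.map Ψ)
  | .inner Ψ i j _ Gt => i < j ∧ IsProductOfMoves Ψ ∧ IsReducedGroebnerBasis Gt (I.map Ψ)
  | .returned Ψ => IsProductOfMoves Ψ ∧ InStronglyStablePosition (I.map Ψ)

theorem Config.Invariant.start {I : Ideal (MvPolynomial (Fin n) k)}
    {G : Finset (MvPolynomial (Fin n) k)} (hG : IsReducedGroebnerBasis G I) :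
    (Config.start G).Invariant I := by
  refine ⟨⟨[], by simp, rfl⟩, ?_⟩
  rwa [show I.map (AlgHom.id k (MvPolynomial (Fin n) k)) = I from Ideal.map_id I]

theorem Config.Invariant.step {I : Ideal (MvPolynomial (Fin n) k)} {c c' : Config k n}
    (h : c.Invariant I) (hs : Step c c') : c'.Invariant I := by
  cases hs with
  | enter hobs hGt =>
    obtain ⟨hΨ, hG⟩ := h
    rw [isMovedBasis_iff hG, Ideal.map_mapₐ] at hGt
    exact ⟨hobs.2.1, hΨ.comp hobs.2.1, hGt⟩
  | again _ hGt =>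
    obtain ⟨hij, hΨ, hG⟩ := h
    rw [isMovedBasis_iff hG, Ideal.map_mapₐ] at hGt
    exact ⟨hij, hΨ.comp hij, hGt⟩
  | leave _ => exact h.2
  | finish hobs => exact ⟨h.1, inStronglyStablePosition_of_forall_not_isObstruction h.2 hobs⟩

/-- Every configuration at which the algorithm has not returned has a successor. -/
theorem Config.Invariant.exists_eq_returned {I : Ideal (MvPolynomial (Fin n) k)} {c : Config k n}
    (h : c.Invariant I) (hstuck : ∀ c', ¬ Step c c') : ∃ Ψ, c = Config.returned Ψ := by
  cases c with
  | outer Ψ G =>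
    by_cases hobs : ∃ g i j, IsObstruction G g i j
    · obtain ⟨g, i, j, hobs⟩ := hobs
      obtain ⟨Gt, hGt⟩ := exists_isReducedGroebnerBasis ((I.map Ψ).map (elementaryMove k i j))
      exact absurd (Step.enter hobs ((isMovedBasis_iff h.2).2 hGt)) (hstuck _)
    · exact absurd (Step.finish hobs) (hstuck _)
  | inner Ψ i j G Gt =>
    by_cases hguard : LsLE (ls Gt) (ls G)
    · obtain ⟨Gt', hGt'⟩ := exists_isReducedGroebnerBasis ((I.map Ψ).map (elementaryMove k i j))
      exact absurd (Step.again hguard ((isMovedBasis_iff h.2.2).2 hGt')) (hstuck _)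
    · exact absurd (Step.leave hguard) (hstuck _)
  | returned Ψ => exact ⟨Ψ, rfl⟩

end SSTrafo

theorem mainTheorem1 {k : Type*} [Field k] [CharZero k] {n : ℕ}
    (I : Ideal (MvPolynomial (Fin n) k))
    (hI : SSTrafo.IsHomogeneousIdeal I)
    (G : Finset (MvPolynomial (Fin n) k))
    (hG : SSTrafo.IsReducedGroebnerBasis G I) :
    -- there is no infinite run of the algorithm on input `G`
    (¬ ∃ run : ℕ → SSTrafo.Config k n, run 0 = SSTrafo.Config.start G ∧
        ∀ t, SSTrafo.Step (run t) (run (t + 1))) ∧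
    ∀ c, Relation.ReflTransGen SSTrafo.Step (SSTrafo.Config.start G) c →
      -- a run cannot get stuck before it has returned
      ((∀ c', ¬ SSTrafo.Step c c') → ∃ Ψ, c = SSTrafo.Config.returned Ψ) ∧
      -- what is returned is a suitable linear coordinate transformation
      ∀ Ψ, c = SSTrafo.Config.returned Ψ →
        (∃ L : List (Fin n × Fin n), (∀ p ∈ L, p.1 < p.2) ∧
          Ψ = (L.map fun p => SSTrafo.elementaryMove k p.1 p.2).prod) ∧
        (∃ A : GL (Fin n) k, Ψ = SSTrafo.linearChange A) ∧
        SSTrafo.InStronglyStablePosition (I.map Ψ) := by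
  refine ⟨SSTrafo.not_exists_run_of_acc (SSTrafo.acc_outer G I hG _), fun c hc => ?_⟩
  have hinv : c.Invariant I := by
    induction hc with
    | refl => exact SSTrafo.Config.Invariant.start hG
    | tail _ hs ih => exact ih.step hs
  refine ⟨hinv.exists_eq_returned, ?_⟩
  rintro Ψ rfl
  exact ⟨hinv.1, hinv.1.exists_eq_linearChange, hinv.2⟩
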